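/- Fix $T>0$, $p_0\in(0,1)$ and $\lambda_{\rm on},\lambda_{\rm off}>0$. Let $G_N(t)$, $t\in[0,T]$, be the dynamic Erdős–Rényi graph on $\{1,\dots,N\}$ with adjacency matrix $A_N(t)=(a_{ij}(t))_{i,j\le N}$. Here $a_{ij}(t)=a_{ji}(t)\in\{0,1\}$, self-loops are allowed, and the processes $a_{ij}$, $i\le j$, are independent. Each $a_{ij}(0)$ equals $1$ with probability $p_0$ and $0$ otherwise. After time $0$ the edge alternates between present ($a_{ij}=1$) and absent ($a_{ij}=0$), with independent holding times that are independent of $a_{ij}(0)$ and exponentially distributed, with rate $\lambda_{\rm on}$ when present and rate $\lambda_{\rm off}$ when absent. The graphs for all $N\ge 1$ are defined on one probability space, with arbitrary joint dependence between different values of $N$ (for instance, $A_N(t)$ may be the top-left $N\times N$ corner of one infinite array). Let $p(t)=P(a_{ij}(t)=1)$, which does not depend on $i,j,N$, and let $\mu_N(t)$ be the largest eigenvalue of $A_N(t)$. Then there are a constant $\eta>0$, events $\Omega_N$ and random variables $\mathcal G_N(t)$ ($N\ge1$, $t\in[0,T]$) such that, for every $N\ge 1$, $P(\Omega_N^{\rm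 c})\le e^{-\eta(\log N)^2}$ and on $\Omega_N$, simultaneously for all $t\in[0,T]$, $$\mu_N(t)=\mathbb E\,\mu_N(t)+\frac1N\sum_{i,j=1}^N\bigl(a_{ij}(t)-p(t)\bigr)+\mathcal G_N(t)\,\frac{(\log N)^4}{\sqrt N}.$$ Moreover $\limsup_{N\to\infty}\sup_{t\in[0,T]}|\mathcal G_N(t)|<\infty$ almost surely, and the error is bounded by a deterministic constant on $\Omega_N$: there is $C<\infty$ such that, for all sufficiently large $N$, $|\mathcal G_N(t)|\le C$ on $\Omega_N$ for all $t\in[0,T]$. -/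

import Mathlib

open MeasureTheory ProbabilityTheory

/-- Duration of the first `k` on-off cycles of one edge, `T_k = ∑_{ℓ ≤ k} ξ⁰_ℓ + ∑_{ℓ ≤ k} ξ¹_ℓ`.
Here `ξ false` is the sequence of off-times, `ξ true` the sequence of on-times, and sequences are
indexed from `0` (so `ξ b ℓ` is the `(ℓ+1)`-st time of its kind). -/
noncomputable def cycleTime (ξ : Bool → ℕ → ℝ) (k : ℕ) : ℝ :=
  ∑ l ∈ Finset.range k, ξ false l + ∑ l ∈ Finset.range k, ξ true l

open Classical in
/-- The state at time `t` (`1` = present, `0` = absent) of an edge with initial state `b` and holding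
times `ξ`: it is in its initial state if `t ∈ [T_k, T_k + ξ^b_{k+1})` for some `k ≥ 0`, and in the
opposite state otherwise. -/
noncomputable def onOffState (b : Bool) (ξ : Bool → ℕ → ℝ) (t : ℝ) : ℝ :=
  if ∃ k : ℕ, t ∈ Set.Ico (cycleTime ξ k) (cycleTime ξ k + ξ b k) then
    (if b then 1 else 0)
  else
    (if b then 0 else 1)

/-- The random input of the exponential on-off Erdős-Rényi dynamic graph on `N` vertices. The
potential edges are the unordered pairs of vertices, self-loops included. `init e` is the initial
state of the edge `e` (`true` with probability `p₀`), `ξ true e` its sequence of on-times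
(exponential with rate `lon`), `ξ false e` its sequence of off-times (exponential with rate
`loff`), and all these random variables are mutually independent. -/
structure IsOnOffInput {Ω : Type*} [MeasurableSpace Ω] (P : Measure Ω) (p₀ lon loff : ℝ) {N : ℕ}
    (init : Sym2 (Fin N) → Ω → Bool) (ξ : Bool → Sym2 (Fin N) → ℕ → Ω → ℝ) : Prop where
  measurable_init : ∀ e, Measurable (init e)
  measurable_time : ∀ b e l, Measurable (ξ b e l)
  law_init : ∀ e, P {ω | init e ω = true} = ENNReal.ofReal p₀
  law_on : ∀ e l, P.map (ξ true e l) = expMeasure lon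
  law_off : ∀ e l, P.map (ξ false e l) = expMeasure loff
  indep : iIndepFun
    (Sum.elim (fun (e : Sym2 (Fin N)) (ω : Ω) => ((init e ω).toNat : ℝ))
      (fun (x : Bool × Sym2 (Fin N) × ℕ) => ξ x.1 x.2.1 x.2.2)) P

/-- The edge process `a_e(t)`. -/
noncomputable def edgeProcess {Ω : Type*} {N : ℕ}
    (init : Sym2 (Fin N) → Ω → Bool) (ξ : Bool → Sym2 (Fin N) → ℕ → Ω → ℝ)
    (e : Sym2 (Fin N)) (t : ℝ) (ω : Ω) : ℝ :=
  onOffState (init e ω) (fun b l => ξ b e l ω) t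

/-- `p(t) = P(a_e(t) = 1)`; its value depends neither on the edge `e` nor on `N`. -/
noncomputable def edgeProb {Ω : Type*} [MeasurableSpace Ω] (P : Measure Ω) {N : ℕ}
    (init : Sym2 (Fin N) → Ω → Bool) (ξ : Bool → Sym2 (Fin N) → ℕ → Ω → ℝ)
    (e : Sym2 (Fin N)) (t : ℝ) : ℝ :=
  P.real {ω | edgeProcess init ξ e t ω = 1}

/-- The adjacency matrix `A_N(t)`, with entries `a_{ij}(t) = a_{ji}(t)`. -/
noncomputable def adjacencyProcess {Ω : Type*} {N : ℕ}
    (init : Sym2 (Fin N) → Ω → Bool) (ξ : Bool → Sym2 (Fin N) → ℕ → Ω → ℝ)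
    (t : ℝ) (ω : Ω) : Matrix (Fin N) (Fin N) ℝ :=
  Matrix.of fun i j => edgeProcess init ξ s(i, j) t ω

/-- The principal (largest) eigenvalue of a real symmetric matrix. -/
noncomputable def principalEigenvalue {N : ℕ} (A : Matrix (Fin N) (Fin N) ℝ) : ℝ :=
  sSup (spectrum ℝ A)

/-- For symmetric `A` of size at least one, the supremum is attained: it is the largest eigenvalue. -/
theorem isGreatest_principalEigenvalue {N : ℕ} (hN : 1 ≤ N) (A : Matrix (Fin N) (Fin N) ℝ)
    (hA : A.IsHermitian) :
    IsGreatest {x : ℝ | Module.End.HasEigenvalue (Matrix.toLin' A) x} (principalEigenvalue A) := by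
  have h : {x : ℝ | Module.End.HasEigenvalue (Matrix.toLin' A) x} = spectrum ℝ A := by
    ext x
    rw [Set.mem_ofPred_eq, Module.End.hasEigenvalue_iff_mem_spectrum, Matrix.spectrum_toLin']
  rw [h]
  have hs := hA.spectrum_real_eq_range_eigenvalues
  have hne : Nonempty (Fin N) := ⟨⟨0, hN⟩⟩
  have hfin : (spectrum ℝ A).Finite := by rw [hs]; exact Set.finite_range _
  have hnon : (spectrum ℝ A).Nonempty := by rw [hs]; exact Set.range_nonempty _
  exact ⟨hnon.csSup_mem hfin, fun x hx => le_csSup hfin.bddAbove hx⟩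

/-! At a fixed time write `A = r e eᵀ + W` with `e` the constant unit vector, `r = N p(t)`, and `W`
the centred adjacency matrix. With overwhelming probability `‖W‖ = O(√N)`, far below `r`, so the top
eigenvalue is an outlier with expansion `μ = r + ⟨We, e⟩ + ‖We‖² / r + O(‖W‖³ / r² + ⟨We, e⟩² / r)`
(`abs_eigenvalue_sub_expansion_le`). The term `⟨We, e⟩` is exactly the linear statistic of the
theorem (`meanStat`). The term `‖We‖²` is the average squared row sum; after truncating the row sums
at `√N L`, McDiarmid's inequality puts it within `√N L²` of a constant, which costs `L² / √N` after
division by `r` (`bernProb_compl_goodConfig_le`). Here `L = log N`, so failure probabilities are of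
the form `exp(-c L²)` up to polynomial factors.

Uniformity in time comes from a grid of mesh `T / N²`. Each of the at most `N²` edges switches
inside a mesh interval with probability `O(N⁻²)` (`measure_switchSet_le`), so more than `L²`
switches are very unlikely (`bernProb_card_ge_le`), and so small a change of `W` does not spoil the
expansion (`abs_principalEigenvalue_sub_le_of_good`). This gives `μ` as the linear statistic plus a
deterministic function of time (`exists_event_expansion`).

The deterministic function is then replaced by `𝔼 μ`: the linear statistic has mean zero, and the
bad event is too improbable for the polynomially bounded remainder to matter
(`exists_event_concentration`). Borel–Cantelli gives the almost sure statement; no relation between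
different `N` is needed. -/

/-! ### Independent Bernoulli coordinates and McDiarmid's inequality, as finite sums. -/

section Bernoulli

variable {ι : Type*} [Fintype ι]

/-- The probability of the configuration `x` under independent Bernoulli(`p`) coordinates. -/
noncomputable def bernWeight (p : ℝ) (x : ι → Bool) : ℝ := ∏ i, if x i then p else 1 - p

/-- The expectation of `F` under independent Bernoulli(`p`) coordinates. -/
noncomputable def bernMean [DecidableEq ι] (p : ℝ) (F : (ι → Bool) → ℝ) : ℝ :=
  ∑ x, bernWeight p x * F x

/-- The probability of `S` under independent Bernoulli(`p`) coordinates. -/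
noncomputable def bernProb [DecidableEq ι] (p : ℝ) (S : Set (ι → Bool)) : ℝ :=
  bernMean p (S.indicator 1)

theorem bernWeight_nonneg {p : ℝ} (hp : p ∈ Set.Icc (0 : ℝ) 1) (x : ι → Bool) :
    0 ≤ bernWeight p x :=
  Finset.prod_nonneg fun i _ => by
    split_ifs
    · exact hp.1
    · linarith [hp.2]

/-- Conditioning on the first coordinate; this drives the inductions below. -/
theorem bernMean_fin_succ (p : ℝ) {n : ℕ} (F : (Fin (n + 1) → Bool) → ℝ) :
    bernMean p F = p * bernMean p (fun x : Fin n → Bool => F (Fin.cons true x)) +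
      (1 - p) * bernMean p (fun x : Fin n → Bool => F (Fin.cons false x)) := by
  unfold bernMean
  rw [← (Fin.consEquiv (fun _ : Fin (n + 1) => Bool)).sum_comp, Fintype.sum_prod_type]
  simp [bernWeight, Fin.consEquiv, Fin.prod_univ_succ, Finset.mul_sum, mul_assoc]

variable [DecidableEq ι]

theorem bernMean_comp_equiv (p : ℝ) {κ : Type*} [Fintype κ] [DecidableEq κ] (e : ι ≃ κ)
    (F : (ι → Bool) → ℝ) : bernMean p (fun y : κ → Bool => F (y ∘ e)) = bernMean p F := by
  unfold bernMean
  rw [← (e.arrowCongr (Equiv.refl Bool)).sum_comp]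
  refine Finset.sum_congr rfl fun x _ => ?_
  congr 1
  · unfold bernWeight
    rw [← e.prod_comp]
    simp
  · refine congrArg F (funext fun i => ?_)
    simp

theorem bernMean_one (p : ℝ) : bernMean p (fun _ : ι → Bool => (1 : ℝ)) = 1 := by
  rw [← bernMean_comp_equiv p (Fintype.equivFin ι)]
  generalize Fintype.card ι = n
  induction n with
  | zero => simp [bernMean, bernWeight]
  | succ n ih => rw [bernMean_fin_succ, ih]; ring

theorem bernMean_const_mul (p c : ℝ) (F : (ι → Bool) → ℝ) :
    bernMean p (fun x => c * F x) = c * bernMean p F := by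
  simp only [bernMean, Finset.mul_sum]
  exact Finset.sum_congr rfl fun _ _ => by ring

theorem bernMean_add (p : ℝ) (F G : (ι → Bool) → ℝ) :
    bernMean p (fun x => F x + G x) = bernMean p F + bernMean p G := by
  simp only [bernMean, mul_add, Finset.sum_add_distrib]

theorem bernMean_sub (p : ℝ) (F G : (ι → Bool) → ℝ) :
    bernMean p (fun x => F x - G x) = bernMean p F - bernMean p G := by
  simp only [bernMean, mul_sub, Finset.sum_sub_distrib]

theorem bernMean_sum (p : ℝ) {κ : Type*} (s : Finset κ) (F : κ → (ι → Bool) → ℝ) :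
    bernMean p (fun x => ∑ k ∈ s, F k x) = ∑ k ∈ s, bernMean p (F k) := by
  simp only [bernMean, Finset.mul_sum]
  exact Finset.sum_comm

theorem bernMean_const (p c : ℝ) : bernMean p (fun _ : ι → Bool => c) = c := by
  simpa [bernMean_one] using bernMean_const_mul p c (fun _ : ι → Bool => (1 : ℝ))

theorem bernMean_mono {p : ℝ} (hp : p ∈ Set.Icc (0 : ℝ) 1) {F G : (ι → Bool) → ℝ}
    (h : ∀ x, F x ≤ G x) : bernMean p F ≤ bernMean p G :=
  Finset.sum_le_sum fun x _ => mul_le_mul_of_nonneg_left (h x) (bernWeight_nonneg hp x)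

theorem abs_bernMean_le {p : ℝ} (hp : p ∈ Set.Icc (0 : ℝ) 1) {F : (ι → Bool) → ℝ} {c : ℝ}
    (h : ∀ x, |F x| ≤ c) : |bernMean p F| ≤ c := by
  rw [abs_le]
  constructor
  · rw [← bernMean_const (ι := ι) p (-c)]
    exact bernMean_mono hp fun x => (abs_le.1 (h x)).1
  · rw [← bernMean_const (ι := ι) p c]
    exact bernMean_mono hp fun x => (abs_le.1 (h x)).2

/-- In expectation the linear term of a centred variable drops out, which leaves a Gaussian moment
bound: Hoeffding's lemma with a worse constant. -/
theorem exp_le_add_exp_sq (x : ℝ) : Real.exp x ≤ x + Real.exp (x ^ 2) := by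
  have h1 := Real.add_one_le_exp (x ^ 2)
  rcases le_total |x| 1 with h | h
  · have := (abs_le.1 (Real.abs_exp_sub_one_sub_id_le h)).2
    linarith
  · rcases le_abs'.1 h with h | h
    · have : Real.exp x ≤ 1 := Real.exp_le_one_iff.2 (by linarith)
      nlinarith
    · have : Real.exp x ≤ Real.exp (x ^ 2) := Real.exp_le_exp.2 (by nlinarith)
      linarith

theorem two_point_exp_le {p : ℝ} (hp : p ∈ Set.Icc (0 : ℝ) 1) {a b c : ℝ} (h : |a - b| ≤ c) :
    p * Real.exp a + (1 - p) * Real.exp b ≤ Real.exp (p * a + (1 - p) * b + c ^ 2) := by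
  obtain ⟨h0, h1⟩ := hp
  set m := p * a + (1 - p) * b with hm
  have key : ∀ q d : ℝ, 0 ≤ q → q ≤ 1 → |d| ≤ c → Real.exp (q * d) ≤ q * d + Real.exp (c ^ 2) := by
    intro q d hq hq1 hd
    refine (exp_le_add_exp_sq _).trans ?_
    refine add_le_add le_rfl (Real.exp_le_exp.2 ?_)
    rw [mul_pow, ← sq_abs d]
    have : |d| ^ 2 ≤ c ^ 2 := by gcongr
    have : q ^ 2 ≤ 1 := by nlinarith
    nlinarith [sq_nonneg |d|]
  have ha := key (1 - p) (a - b) (by linarith) (by linarith) h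
  have hb := key p (b - a) h0 h1 (by rwa [abs_sub_comm])
  have ea : Real.exp a = Real.exp m * Real.exp ((1 - p) * (a - b)) := by
    rw [← Real.exp_add]; congr 1; rw [hm]; ring
  have eb : Real.exp b = Real.exp m * Real.exp (p * (b - a)) := by
    rw [← Real.exp_add]; congr 1; rw [hm]; ring
  rw [ea, eb, Real.exp_add (p * a + (1 - p) * b), ← hm]
  -- The deviations from the mean have weighted sum zero, so the linear terms of `key` cancel.
  have : p * Real.exp ((1 - p) * (a - b)) + (1 - p) * Real.exp (p * (b - a)) ≤
      Real.exp (c ^ 2) := by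
    have := mul_le_mul_of_nonneg_left ha h0
    have := mul_le_mul_of_nonneg_left hb (sub_nonneg.2 h1)
    nlinarith
  nlinarith [mul_le_mul_of_nonneg_left this (Real.exp_pos m).le]

/-- The martingale argument: given the first coordinate the induction hypothesis applies, and the
two conditional means differ by at most `c 0`, so the two-point bound costs one further `c 0 ^ 2`.
-/
theorem bernMean_exp_le_fin {p : ℝ} (hp : p ∈ Set.Icc (0 : ℝ) 1) {n : ℕ}
    (F : (Fin n → Bool) → ℝ) (c : Fin n → ℝ)
    (hF : ∀ i x b, |F (Function.update x i b) - F x| ≤ c i) :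
    bernMean p (fun x => Real.exp (F x)) ≤ Real.exp (bernMean p F + ∑ i, c i ^ 2) := by
  induction n with
  | zero => simp [bernMean, bernWeight]
  | succ n ih =>
    have hb : ∀ b : Bool, bernMean p (fun x : Fin n → Bool => Real.exp (F (Fin.cons b x))) ≤
        Real.exp (bernMean p (fun x : Fin n → Bool => F (Fin.cons b x))) *
          Real.exp (∑ i : Fin n, c i.succ ^ 2) := by
      intro b
      rw [← Real.exp_add]
      refine ih (fun x => F (Fin.cons b x)) (fun i => c i.succ) fun i x b' => ?_
      rw [Fin.cons_update]
      exact hF _ _ _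
    have h0 : |bernMean p (fun x : Fin n → Bool => F (Fin.cons true x)) -
        bernMean p (fun x : Fin n → Bool => F (Fin.cons false x))| ≤ c 0 := by
      rw [← bernMean_sub]
      refine abs_bernMean_le hp fun x => ?_
      have := hF 0 (Fin.cons false x) true
      rwa [Fin.update_cons_zero] at this
    rw [bernMean_fin_succ, bernMean_fin_succ p F, Fin.sum_univ_succ, ← add_assoc, Real.exp_add]
    refine le_trans ?_ (mul_le_mul_of_nonneg_right (two_point_exp_le hp h0) (Real.exp_pos _).le)
    rw [add_mul, mul_assoc, mul_assoc]
    exact add_le_add (mul_le_mul_of_nonneg_left (hb true) hp.1)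
      (mul_le_mul_of_nonneg_left (hb false) (sub_nonneg.2 hp.2))

/-- McDiarmid's bound on the exponential moment of a function with bounded differences. -/
theorem bernMean_exp_le {p : ℝ} (hp : p ∈ Set.Icc (0 : ℝ) 1)
    (F : (ι → Bool) → ℝ) (c : ι → ℝ)
    (hF : ∀ i x b, |F (Function.update x i b) - F x| ≤ c i) :
    bernMean p (fun x => Real.exp (F x)) ≤ Real.exp (bernMean p F + ∑ i, c i ^ 2) := by
  have e := Fintype.equivFin ι
  rw [← bernMean_comp_equiv p e, ← bernMean_comp_equiv p e F, ← e.symm.sum_comp]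
  refine bernMean_exp_le_fin hp (fun y => F (y ∘ e)) (fun i => c (e.symm i)) fun i x b => ?_
  rw [Function.update_comp_equiv]
  exact hF _ _ _

theorem bernProb_mono {p : ℝ} (hp : p ∈ Set.Icc (0 : ℝ) 1) {S T : Set (ι → Bool)} (h : S ⊆ T) :
    bernProb p S ≤ bernProb p T :=
  bernMean_mono hp fun x => Set.indicator_le_indicator_of_subset h (fun _ => zero_le_one) x

theorem bernProb_union_le {p : ℝ} (hp : p ∈ Set.Icc (0 : ℝ) 1) (S T : Set (ι → Bool)) :
    bernProb p (S ∪ T) ≤ bernProb p S + bernProb p T := by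
  unfold bernProb
  rw [← bernMean_add]
  refine bernMean_mono hp fun x => ?_
  by_cases h1 : x ∈ S <;> by_cases h2 : x ∈ T <;> simp [h1, h2]

theorem bernProb_iUnion_le {p : ℝ} (hp : p ∈ Set.Icc (0 : ℝ) 1) {κ : Type*} [Fintype κ]
    (S : κ → Set (ι → Bool)) : bernProb p (⋃ k, S k) ≤ ∑ k, bernProb p (S k) := by
  unfold bernProb
  rw [← bernMean_sum]
  refine bernMean_mono hp fun x => ?_
  have h0 : ∀ k, 0 ≤ (S k).indicator (1 : (ι → Bool) → ℝ) x :=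
    fun k => Set.indicator_nonneg (fun _ _ => zero_le_one) x
  by_cases h : x ∈ ⋃ k, S k
  · obtain ⟨k, hk⟩ := Set.mem_iUnion.1 h
    rw [Set.indicator_of_mem h]
    refine le_trans (le_of_eq ?_) (Finset.single_le_sum (fun k _ => h0 k) (Finset.mem_univ k))
    simp [hk]
  · rw [Set.indicator_of_notMem h]
    exact Finset.sum_nonneg fun k _ => h0 k

theorem bernProb_le_of_le {p : ℝ} (hp : p ∈ Set.Icc (0 : ℝ) 1) (F : (ι → Bool) → ℝ) {a : ℝ}
    (S : Set (ι → Bool)) (hS : ∀ x ∈ S, a ≤ F x) :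
    bernProb p S ≤ Real.exp (-a) * bernMean p (fun x => Real.exp (F x)) := by
  unfold bernProb
  rw [← bernMean_const_mul]
  refine bernMean_mono hp fun x => ?_
  by_cases h : x ∈ S
  · rw [Set.indicator_of_mem h, ← Real.exp_add, Pi.one_apply]
    exact Real.one_le_exp (by linarith [hS x h])
  · rw [Set.indicator_of_notMem h]
    positivity

theorem bernProb_ge_add_le {p : ℝ} (hp : p ∈ Set.Icc (0 : ℝ) 1)
    (F : (ι → Bool) → ℝ) (c : ι → ℝ)
    (hF : ∀ i x b, |F (Function.update x i b) - F x| ≤ c i) {V a : ℝ} (hV : 0 < V) (ha : 0 ≤ a)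
    (hcV : ∑ i, c i ^ 2 ≤ V) :
    bernProb p {x | a ≤ F x - bernMean p F} ≤ Real.exp (-(a ^ 2 / (4 * V))) := by
  -- This is the minimiser of `l ^ 2 * V - l * a`.
  set l := a / (2 * V) with hl
  have hl0 : 0 ≤ l := by positivity
  have h1 := bernProb_le_of_le hp (fun x => l * F x) (a := l * (a + bernMean p F))
    {x | a ≤ F x - bernMean p F} fun x hx => by
      have : a ≤ F x - bernMean p F := hx
      exact mul_le_mul_of_nonneg_left (by linarith) hl0
  have h2 := bernMean_exp_le hp (fun x => l * F x) (fun i => l * c i) fun i x b => by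
    rw [← mul_sub, abs_mul, abs_of_nonneg hl0]
    exact mul_le_mul_of_nonneg_left (hF i x b) hl0
  refine h1.trans ((mul_le_mul_of_nonneg_left h2 (Real.exp_pos _).le).trans ?_)
  rw [← Real.exp_add, Real.exp_le_exp, bernMean_const_mul]
  have h3 : ∑ i, (l * c i) ^ 2 ≤ l ^ 2 * V := by
    simp only [mul_pow, ← Finset.mul_sum]
    exact mul_le_mul_of_nonneg_left hcV (sq_nonneg _)
  have h4 : l ^ 2 * V - l * a = -(a ^ 2 / (4 * V)) := by
    rw [hl]; field_simp; ring
  linarith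

/-- McDiarmid's inequality. -/
theorem bernProb_abs_sub_ge_le {p : ℝ} (hp : p ∈ Set.Icc (0 : ℝ) 1)
    (F : (ι → Bool) → ℝ) (c : ι → ℝ)
    (hF : ∀ i x b, |F (Function.update x i b) - F x| ≤ c i) {V a : ℝ} (hV : 0 < V) (ha : 0 ≤ a)
    (hcV : ∑ i, c i ^ 2 ≤ V) :
    bernProb p {x | a ≤ |F x - bernMean p F|} ≤ 2 * Real.exp (-(a ^ 2 / (4 * V))) := by
  have h1 := bernProb_ge_add_le hp F c hF (a := a) hV ha hcV
  have h2 := bernProb_ge_add_le hp (fun x => (-1) * F x) c (fun i x b => by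
    have := hF i x b
    rwa [show -1 * F (Function.update x i b) - -1 * F x =
      -(F (Function.update x i b) - F x) by ring, abs_neg]) (a := a) hV ha hcV
  rw [bernMean_const_mul] at h2
  refine (bernProb_mono hp ?_).trans ((bernProb_union_le hp _ _).trans
    (by rw [two_mul]; exact add_le_add h1 h2))
  intro x hx
  rcases le_abs.1 (show a ≤ |F x - bernMean p F| from hx) with h | h
  · exact Or.inl h
  · refine Or.inr ?_
    change a ≤ _
    linarith

end Bernoulli

/-! ### Symmetric operators, Rayleigh quotients and the outlier eigenvalue. -/

section Operator

/-- The operator on Euclidean space with matrix `A`. -/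
noncomputable abbrev matrixOp {N : ℕ} (A : Matrix (Fin N) (Fin N) ℝ) :
    EuclideanSpace ℝ (Fin N) →L[ℝ] EuclideanSpace ℝ (Fin N) :=
  Matrix.toEuclideanCLM (𝕜 := ℝ) A

theorem matrixOp_apply {N : ℕ} (A : Matrix (Fin N) (Fin N) ℝ) (v : EuclideanSpace ℝ (Fin N))
    (i : Fin N) : matrixOp A v i = ∑ j, A i j * v j := rfl

theorem inner_matrixOp {N : ℕ} (A : Matrix (Fin N) (Fin N) ℝ) (v w : EuclideanSpace ℝ (Fin N)) :
    inner ℝ (matrixOp A v) w = ∑ i, ∑ j, A i j * (w i * v j) := by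
  rw [PiLp.inner_apply]
  refine Finset.sum_congr rfl fun i _ => ?_
  rw [matrixOp_apply]
  simp only [RCLike.inner_apply, conj_trivial, Finset.mul_sum]
  exact Finset.sum_congr rfl fun j _ => by ring

theorem matrixOp_isSymmetric {N : ℕ} {A : Matrix (Fin N) (Fin N) ℝ} (hA : A.IsHermitian)
    (v w : EuclideanSpace ℝ (Fin N)) :
    inner ℝ (matrixOp A v) w = inner ℝ v (matrixOp A w) := by
  rw [real_inner_comm (matrixOp A w), inner_matrixOp, inner_matrixOp, Finset.sum_comm]
  refine Finset.sum_congr rfl fun i _ => Finset.sum_congr rfl fun j _ => ?_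
  rw [← hA.apply i j]
  simp only [star_trivial]
  ring

theorem norm_le_sum_abs {N : ℕ} (v : EuclideanSpace ℝ (Fin N)) : ‖v‖ ≤ ∑ i, |v i| := by
  rw [EuclideanSpace.norm_eq]
  refine Real.sqrt_le_iff.2 ⟨by positivity, ?_⟩
  simpa using Finset.sum_sq_le_sq_sum_of_nonneg (s := Finset.univ) (f := fun i => |v i|)
    (fun i _ => abs_nonneg _)

theorem norm_matrixOp_le_sum {N : ℕ} (A : Matrix (Fin N) (Fin N) ℝ) :
    ‖matrixOp A‖ ≤ ∑ i, ∑ j, |A i j| := by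
  refine ContinuousLinearMap.opNorm_le_bound _ (by positivity) fun v => ?_
  refine (norm_le_sum_abs _).trans ?_
  rw [Finset.sum_mul]
  refine Finset.sum_le_sum fun i _ => ?_
  rw [matrixOp_apply, Finset.sum_mul]
  refine (Finset.abs_sum_le_sum_abs _ _).trans (Finset.sum_le_sum fun j _ => ?_)
  rw [abs_mul]
  exact mul_le_mul_of_nonneg_left (by simpa using PiLp.norm_apply_le v j) (abs_nonneg _)

/-- A symmetric operator almost attains its norm on quadratic forms of vectors in the unit ball. -/
theorem exists_norm_le_abs_inner {E : Type*} [NormedAddCommGroup E] [InnerProductSpace ℝ E]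
    (T : E →L[ℝ] E) (hT : ∀ v w, inner ℝ (T v) w = inner ℝ v (T w)) :
    ∃ v, ‖v‖ ≤ 1 ∧ 15 / 16 * ‖T‖ ≤ |inner ℝ (T v) v| := by
  rcases (norm_nonneg T).eq_or_lt with h | h
  · exact ⟨0, by simp, by simp [← h]⟩
  have h1 : 15 / 16 * ‖T‖ < ⨆ x, |T.rayleighQuotient x| := by
    rw [← T.norm_eq_iSup_rayleighQuotient hT]
    linarith
  obtain ⟨x, hx⟩ := exists_lt_of_lt_ciSup h1
  have hx0 : x ≠ 0 := by
    rintro rfl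
    simp at hx
    linarith
  refine ⟨‖x‖⁻¹ • x, by rw [norm_smul]; simp [hx0], hx.le.trans (le_of_eq ?_)⟩
  rw [ContinuousLinearMap.rayleighQuotient, ContinuousLinearMap.reApplyInnerSelf_apply]
  simp only [map_smul, inner_smul_left, inner_smul_right, RCLike.re_to_real, conj_trivial]
  congr 1
  field_simp

/-- Second order expansion of the outlier eigenvalue of a rank one perturbation. -/
theorem abs_eigenvalue_sub_expansion_le {E : Type*} [NormedAddCommGroup E]
    [InnerProductSpace ℝ E] (T : E →L[ℝ] E) (hT : ∀ v w, inner ℝ (T v) w = inner ℝ v (T w))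
    {e v : E} (he : ‖e‖ = 1) (hv : v ≠ 0) {r w μ : ℝ} (hr : 0 < r) (hw : ‖T‖ ≤ w)
    (hwr : 4 * w ≤ r) (hev : (r * inner ℝ e v) • e + T v = μ • v) (hμ : r - w ≤ μ) :
    |μ - r - inner ℝ (T e) e - ‖T e‖ ^ 2 / r| ≤
      10 * (w ^ 3 / r ^ 2 + (inner ℝ (T e) e) ^ 2 / r) := by
  have hw0 : 0 ≤ w := (norm_nonneg _).trans hw
  have hμ34 : 3 / 4 * r ≤ μ := by linarith
  have hμ0 : 0 < μ := by linarith
  have hTb : ∀ u : E, ‖T u‖ ≤ w * ‖u‖ := fun u =>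
    (T.le_opNorm u).trans (mul_le_mul_of_nonneg_right hw (norm_nonneg _))
  -- An eigenvector orthogonal to `e` would be one of `T` alone, but `μ ≥ 3r/4` exceeds `‖T‖ ≤ r/4`.
  have hev0 : inner ℝ e v ≠ 0 := by
    intro h
    rw [h, mul_zero, zero_smul, zero_add] at hev
    have h1 : μ * ‖v‖ ≤ w * ‖v‖ := by
      have := hTb v
      rwa [hev, norm_smul, Real.norm_of_nonneg hμ0.le] at this
    have := le_of_mul_le_mul_right h1 (norm_pos_iff.2 hv)
    linarith
  obtain ⟨u, hu1, hu⟩ : ∃ u : E, inner ℝ e u = 1 ∧ r • e + T u = μ • u := by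
    refine ⟨(inner ℝ e v)⁻¹ • v, by rw [inner_smul_right]; field_simp, ?_⟩
    have := congrArg (fun y => (inner ℝ e v)⁻¹ • y) hev
    simp only [smul_add, smul_smul] at this
    rw [map_smul, smul_smul, mul_comm μ, ← this]
    congr 2
    field_simp
  have hun : ‖u‖ ≤ 2 := by
    have h1 : μ * ‖u‖ ≤ r + w * ‖u‖ := by
      calc μ * ‖u‖ = ‖r • e + T u‖ := by rw [hu, norm_smul, Real.norm_of_nonneg hμ0.le]
        _ ≤ ‖r • e‖ + ‖T u‖ := norm_add_le _ _
        _ ≤ r + w * ‖u‖ := by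
          rw [norm_smul, he, mul_one, Real.norm_of_nonneg hr.le]
          linarith [hTb u]
    nlinarith [norm_nonneg u]
  set x₁ := inner ℝ (T e) e with hx₁
  set x₂ := ‖T e‖ ^ 2 with hx₂
  set q := inner ℝ (T e) u with hq
  set s := inner ℝ (T e) (T u) with hs
  have hTe : ‖T e‖ ≤ w := by simpa [he] using hTb e
  have hTu : ‖T u‖ ≤ 2 * w := (hTb u).trans (by nlinarith)
  have hTTe : ‖T (T e)‖ ≤ w ^ 2 := (hTb _).trans (by nlinarith)
  -- Pairing the eigenvalue equation with `e`, `T e` and `T (T e)` yields three scalar equations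
  -- that determine `μ` up to the small remainder `z`.
  have e1 : μ = r + q := by
    have := congrArg (inner ℝ e) hu
    rw [inner_add_right, inner_smul_right, inner_smul_right, hu1, real_inner_self_eq_norm_sq, he,
      ← hT] at this
    linarith
  have e2 : μ * q = r * x₁ + s := by
    have := congrArg (inner ℝ (T e)) hu
    rw [inner_add_right, inner_smul_right, inner_smul_right] at this
    linarith
  have e3 : μ * s = r * x₂ + inner ℝ (T (T e)) (T u) := by
    have := congrArg (inner ℝ (T (T e))) hu
    rw [inner_add_right, inner_smul_right, inner_smul_right, hT (T e) e, hT (T e) u,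
      real_inner_self_eq_norm_sq] at this
    linarith
  set z := inner ℝ (T (T e)) (T u) with hz
  have hx₂w : x₂ ≤ w ^ 2 := by rw [hx₂]; gcongr
  have hx₂0 : 0 ≤ x₂ := sq_nonneg _
  have hqb : |q| ≤ 2 * w := (abs_real_inner_le_norm _ _).trans (by nlinarith [norm_nonneg (T e)])
  have hsb : |s| ≤ 2 * w ^ 2 :=
    (abs_real_inner_le_norm _ _).trans (by nlinarith [norm_nonneg (T e), norm_nonneg (T u)])
  have hzb : |z| ≤ 2 * w ^ 3 :=
    (abs_real_inner_le_norm _ _).trans (by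
      calc _ ≤ w ^ 2 * (2 * w) := by gcongr
        _ = _ := by ring)
  have hsx : |s - x₂| ≤ 16 / 3 * (w ^ 3 / r) := by
    have h1 : s - x₂ = (z - q * x₂) / μ := by
      field_simp
      rw [e1] at e3 ⊢
      linarith
    have h2 : |z - q * x₂| ≤ 4 * w ^ 3 := by
      calc |z - q * x₂| ≤ |z| + |q * x₂| := abs_sub _ _
        _ ≤ 2 * w ^ 3 + 2 * w * w ^ 2 := by
          rw [abs_mul, abs_of_nonneg hx₂0]
          gcongr
        _ = _ := by ring
    rw [h1, abs_div, abs_of_pos hμ0, div_le_iff₀ hμ0]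
    calc |z - q * x₂| ≤ 4 * w ^ 3 := h2
      _ = 16 / 3 * (w ^ 3 / r) * (3 / 4 * r) := by field_simp; ring
      _ ≤ _ := by gcongr
  have hqq : |q| ≤ 4 / 3 * (|x₁| + 2 * w ^ 2 / r) := by
    have h1 : q = (r * x₁ + s) / μ := by field_simp; linarith
    rw [h1, abs_div, abs_of_pos hμ0, div_le_iff₀ hμ0]
    calc |r * x₁ + s| ≤ |r * x₁| + |s| := abs_add_le _ _
      _ ≤ r * |x₁| + 2 * w ^ 2 := by rw [abs_mul, abs_of_pos hr]; gcongr
      _ = 4 / 3 * (|x₁| + 2 * w ^ 2 / r) * (3 / 4 * r) := by field_simp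
      _ ≤ _ := by gcongr
  have hq2 : q ^ 2 ≤ 32 / 9 * (x₁ ^ 2 + 4 * (w ^ 2 / r) ^ 2) := by
    rw [← sq_abs q, ← sq_abs x₁]
    calc |q| ^ 2 ≤ (4 / 3 * (|x₁| + 2 * w ^ 2 / r)) ^ 2 := by gcongr
      _ ≤ _ := by
        have : 2 * w ^ 2 / r = 2 * (w ^ 2 / r) := by ring
        rw [this]
        nlinarith [sq_nonneg (|x₁| - 2 * (w ^ 2 / r))]
  have hw4 : 4 * (w ^ 2 / r) ^ 2 / r ≤ w ^ 3 / r ^ 2 := by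
    have : 4 * (w ^ 2 / r) ^ 2 / r = (4 * w) * (w ^ 3) / (r * r ^ 2) := by field_simp
    rw [this]
    calc (4 * w) * (w ^ 3) / (r * r ^ 2) ≤ r * w ^ 3 / (r * r ^ 2) := by gcongr
      _ = _ := by field_simp
  -- Inserting `μ = r + q` in `e2` gives `q = x₁ + s / r - q ^ 2 / r`; only `s ≈ x₂` and the size of
  -- `q` remain to be used.
  have main : μ - r - x₁ - x₂ / r = (s - x₂) / r - q ^ 2 / r := by
    rw [e1] at e2 ⊢
    field_simp
    linarith
  rw [main]
  have hA : |(s - x₂) / r| ≤ 16 / 3 * (w ^ 3 / r ^ 2) := by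
    rw [abs_div, abs_of_pos hr, div_le_iff₀ hr]
    refine hsx.trans (le_of_eq ?_)
    field_simp
  have hB : q ^ 2 / r ≤ 32 / 9 * (x₁ ^ 2 / r + w ^ 3 / r ^ 2) := by
    calc q ^ 2 / r ≤ 32 / 9 * (x₁ ^ 2 + 4 * (w ^ 2 / r) ^ 2) / r := by gcongr
      _ = 32 / 9 * (x₁ ^ 2 / r + 4 * (w ^ 2 / r) ^ 2 / r) := by ring
      _ ≤ _ := by gcongr
  have h0 : 0 ≤ x₁ ^ 2 / r := by positivity
  have h1 : 0 ≤ w ^ 3 / r ^ 2 := by positivity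
  calc |(s - x₂) / r - q ^ 2 / r| ≤ |(s - x₂) / r| + |q ^ 2 / r| := abs_sub _ _
    _ ≤ 16 / 3 * (w ^ 3 / r ^ 2) + 32 / 9 * (x₁ ^ 2 / r + w ^ 3 / r ^ 2) := by
      rw [abs_of_nonneg (by positivity : 0 ≤ q ^ 2 / r)]
      exact add_le_add hA hB
    _ ≤ _ := by linarith

theorem exists_principalEigenvector {N : ℕ} (hN : 1 ≤ N) {A : Matrix (Fin N) (Fin N) ℝ}
    (hA : A.IsHermitian) : ∃ v, v ≠ 0 ∧ matrixOp A v = principalEigenvalue A • v := by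
  obtain ⟨v, hv⟩ := (isGreatest_principalEigenvalue hN A hA).1.exists_hasEigenvector
  refine ⟨WithLp.toLp 2 v, fun h => hv.2 ?_, ?_⟩
  · simpa using h
  · have := hv.apply_eq_smul
    rw [Matrix.toLin'_apply] at this
    rw [matrixOp, Matrix.toEuclideanCLM_toLp, this]
    rfl

/-- The supremum of the Rayleigh quotient of a symmetric operator is itself an eigenvalue. Tested on
the constant vector, this certifies that the principal eigenvalue is the outlier. -/
theorem inner_matrixOp_le_principalEigenvalue {N : ℕ} (hN : 1 ≤ N) {A : Matrix (Fin N) (Fin N) ℝ}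
    (hA : A.IsHermitian) {v : EuclideanSpace ℝ (Fin N)} (hv : ‖v‖ = 1) :
    inner ℝ (matrixOp A v) v ≤ principalEigenvalue A := by
  have : Nonempty (Fin N) := ⟨⟨0, hN⟩⟩
  have hv0 : v ≠ 0 := by
    rintro rfl
    simp at hv
  have : Nontrivial (EuclideanSpace ℝ (Fin N)) := ⟨⟨v, 0, hv0⟩⟩
  have hs : ((matrixOp A : _ →L[ℝ] _) : EuclideanSpace ℝ (Fin N) →ₗ[ℝ] _).IsSymmetric :=
    matrixOp_isSymmetric hA
  have h := hs.hasEigenvalue_iSup_of_finiteDimensional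
  set t := (⨆ x : { x : EuclideanSpace ℝ (Fin N) // x ≠ 0 },
    RCLike.re (inner ℝ (((matrixOp A : _ →L[ℝ] _) : EuclideanSpace ℝ (Fin N) →ₗ[ℝ] _) x)
      (x : EuclideanSpace ℝ (Fin N))) / ‖(x : EuclideanSpace ℝ (Fin N))‖ ^ 2 : ℝ) with ht
  have h1 : t ≤ principalEigenvalue A := by
    refine (isGreatest_principalEigenvalue hN A hA).2 ?_
    obtain ⟨u, hu⟩ := h.exists_hasEigenvector
    have hu' := hu.apply_eq_smul
    refine Module.End.hasEigenvalue_of_hasEigenvector (x := u.ofLp) ⟨?_, ?_⟩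
    · rw [Module.End.mem_eigenspace_iff, Matrix.toLin'_apply]
      exact congrArg WithLp.ofLp hu'
    · simpa using hu.2
  refine le_trans ?_ h1
  have hb : BddAbove (Set.range fun x : { x : EuclideanSpace ℝ (Fin N) // x ≠ 0 } =>
      RCLike.re (inner ℝ (((matrixOp A : _ →L[ℝ] _) : EuclideanSpace ℝ (Fin N) →ₗ[ℝ] _) x)
        (x : EuclideanSpace ℝ (Fin N))) / ‖(x : EuclideanSpace ℝ (Fin N))‖ ^ 2) := by
    refine ⟨‖matrixOp A‖, ?_⟩
    rintro _ ⟨x, rfl⟩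
    exact (le_abs_self _).trans ((matrixOp A).rayleighQuotient_le_norm x)
  refine le_trans (le_of_eq ?_) (le_ciSup hb ⟨v, hv0⟩)
  simp [hv]

theorem abs_principalEigenvalue_le {N : ℕ} (hN : 1 ≤ N) {A : Matrix (Fin N) (Fin N) ℝ}
    (hA : A.IsHermitian) : |principalEigenvalue A| ≤ ‖matrixOp A‖ := by
  obtain ⟨v, hv, h⟩ := exists_principalEigenvector hN hA
  have h1 := (matrixOp A).le_opNorm v
  rw [h, norm_smul] at h1
  exact le_of_mul_le_mul_right h1 (norm_pos_iff.2 hv)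

end Operator

/-! ### Linear statistics and operator norm of the centred adjacency matrix. -/

section Configuration

variable {N : ℕ}

/-- The adjacency matrix of a configuration of edges. -/
def configMatrix (x : Sym2 (Fin N) → Bool) : Matrix (Fin N) (Fin N) ℝ :=
  Matrix.of fun i j => if x s(i, j) then 1 else 0

/-- The adjacency matrix of a configuration of edges, centered at edge density `p`. -/
def centeredMatrix (p : ℝ) (x : Sym2 (Fin N) → Bool) : Matrix (Fin N) (Fin N) ℝ :=
  Matrix.of fun i j => (if x s(i, j) then 1 else 0) - p

theorem configMatrix_isHermitian (x : Sym2 (Fin N) → Bool) : (configMatrix x).IsHermitian := by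
  ext i j
  simp [configMatrix, Sym2.eq_swap]

theorem centeredMatrix_isHermitian (p : ℝ) (x : Sym2 (Fin N) → Bool) :
    (centeredMatrix p x).IsHermitian := by
  ext i j
  simp [centeredMatrix, Sym2.eq_swap]

/-- An edge fills one or two matrix entries; this is the source of the factors 2 in the bounds on
edge changes. -/
theorem card_fiber_sym2_mk_le (e : Sym2 (Fin N)) :
    (Finset.univ.filter fun q : Fin N × Fin N => s(q.1, q.2) = e).card ≤ 2 := by
  induction e using Sym2.inductionOn with
  | _ a b =>
    refine (Finset.card_le_card (t := {(a, b), (b, a)}) fun q hq => ?_).trans Finset.card_le_two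
    simp only [Finset.mem_filter, Finset.mem_univ, true_and, Sym2.eq_iff] at hq
    simp only [Finset.mem_insert, Finset.mem_singleton, Prod.ext_iff]
    exact hq

theorem bernMean_ite {ι : Type*} [Fintype ι] [DecidableEq ι] (p : ℝ) (e : ι) :
    bernMean p (fun x : ι → Bool => if x e then (1 : ℝ) else 0) = p := by
  have h : ∀ x : ι → Bool, bernWeight p x * (if x e then (1 : ℝ) else 0) =
      ∏ i, (if x i then p else 1 - p) * (if i = e then (if x i then (1 : ℝ) else 0) else 1) := by
    intro x
    rw [Finset.prod_mul_distrib, Finset.prod_ite_eq' Finset.univ e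
      (fun i => if x i then (1 : ℝ) else 0)]
    simp [bernWeight]
  unfold bernMean
  simp only [h]
  have h2 := Finset.prod_univ_sum (fun _ : ι => (Finset.univ : Finset Bool))
    (fun i b => (if b then p else 1 - p) * (if i = e then (if b then (1 : ℝ) else 0) else 1))
  rw [Fintype.piFinset_univ] at h2
  -- The sum over configurations factorises over coordinates; every factor other than that of `e` is
  -- `p + (1 - p) = 1`.
  rw [← h2, Finset.prod_eq_single e]
  · simp
  · intro i _ hi
    simp [hi]
  · simp

/-- A linear statistic `∑ᵢⱼ gᵢⱼ (aᵢⱼ - p)` of a configuration. -/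
def linearStat (p : ℝ) (g : Fin N → Fin N → ℝ) (x : Sym2 (Fin N) → Bool) : ℝ :=
  ∑ i, ∑ j, centeredMatrix p x i j * g i j

theorem bernMean_linearStat (p : ℝ) (g : Fin N → Fin N → ℝ) :
    bernMean p (linearStat p g) = 0 := by
  unfold linearStat
  rw [bernMean_sum]
  refine Finset.sum_eq_zero fun i _ => ?_
  rw [bernMean_sum]
  refine Finset.sum_eq_zero fun j _ => ?_
  have : (fun x : Sym2 (Fin N) → Bool => centeredMatrix p x i j * g i j) =
      fun x => g i j * ((if x s(i, j) then 1 else 0) - p) := by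
    ext x
    rw [mul_comm]
    rfl
  rw [this, bernMean_const_mul, bernMean_sub, bernMean_ite, bernMean_const]
  ring

/-- The total weight of an edge in a linear statistic. -/
def edgeWeight (g : Fin N → Fin N → ℝ) (e : Sym2 (Fin N)) : ℝ :=
  ∑ q ∈ Finset.univ.filter (fun q : Fin N × Fin N => s(q.1, q.2) = e), |g q.1 q.2|

theorem sum_edgeWeight_sq_le (g : Fin N → Fin N → ℝ) :
    ∑ e, edgeWeight g e ^ 2 ≤ 2 * ∑ i, ∑ j, g i j ^ 2 := by
  have h : ∀ e, edgeWeight g e ^ 2 ≤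
      ∑ q ∈ Finset.univ.filter (fun q : Fin N × Fin N => s(q.1, q.2) = e), 2 * g q.1 q.2 ^ 2 := by
    intro e
    refine sq_sum_le_card_mul_sum_sq.trans ?_
    simp only [sq_abs, ← Finset.mul_sum]
    exact mul_le_mul_of_nonneg_right (by exact_mod_cast card_fiber_sym2_mk_le e)
      (Finset.sum_nonneg fun _ _ => sq_nonneg _)
  refine (Finset.sum_le_sum fun e _ => h e).trans (le_of_eq ?_)
  rw [Finset.sum_fiberwise, Fintype.sum_prod_type]
  simp only [Finset.mul_sum]

theorem abs_linearStat_update_sub_le (p : ℝ) (g : Fin N → Fin N → ℝ) (e : Sym2 (Fin N))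
    (x : Sym2 (Fin N) → Bool) (b : Bool) :
    |linearStat p g (Function.update x e b) - linearStat p g x| ≤ edgeWeight g e := by
  unfold linearStat edgeWeight
  rw [← Fintype.sum_prod_type'
      (f := fun i j => centeredMatrix p (Function.update x e b) i j * g i j),
    ← Fintype.sum_prod_type' (f := fun i j => centeredMatrix p x i j * g i j),
    ← Finset.sum_sub_distrib, Finset.sum_filter]
  refine (Finset.abs_sum_le_sum_abs _ _).trans (Finset.sum_le_sum fun q _ => ?_)
  rw [← sub_mul, abs_mul]
  split_ifs with h
  · refine mul_le_of_le_one_left (abs_nonneg _) ?_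
    simp only [centeredMatrix, Matrix.of_apply]
    rw [abs_le]
    constructor <;> split_ifs <;> linarith
  · simp [centeredMatrix, Function.update_of_ne h]

theorem bernMean_exp_linearStat_le {p : ℝ} (hp : p ∈ Set.Icc (0 : ℝ) 1) (l : ℝ)
    (g : Fin N → Fin N → ℝ) :
    bernMean p (fun x => Real.exp (l * linearStat p g x)) ≤
      Real.exp (2 * l ^ 2 * ∑ i, ∑ j, g i j ^ 2) := by
  have h := bernMean_exp_le hp (fun x => l * linearStat p g x) (fun e => |l| * edgeWeight g e)
    fun e x b => by
      rw [← mul_sub, abs_mul]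
      exact mul_le_mul_of_nonneg_left (abs_linearStat_update_sub_le p g e x b) (abs_nonneg _)
  refine h.trans (Real.exp_le_exp.2 ?_)
  rw [bernMean_const_mul, bernMean_linearStat, mul_zero, zero_add]
  simp only [mul_pow, sq_abs, ← Finset.mul_sum]
  nlinarith [mul_le_mul_of_nonneg_left (sum_edgeWeight_sq_le g) (sq_nonneg l)]

theorem bernProb_abs_linearStat_ge_le {p : ℝ} (hp : p ∈ Set.Icc (0 : ℝ) 1)
    (g : Fin N → Fin N → ℝ) {V a : ℝ} (hV : 0 < V) (ha : 0 ≤ a)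
    (hg : ∑ i, ∑ j, g i j ^ 2 ≤ V) :
    bernProb p {x | a ≤ |linearStat p g x|} ≤ 2 * Real.exp (-(a ^ 2 / (8 * V))) := by
  have := bernProb_abs_sub_ge_le hp (linearStat p g) (edgeWeight g)
    (abs_linearStat_update_sub_le p g) (V := 2 * V) (a := a) (by linarith) ha
    ((sum_edgeWeight_sq_le g).trans (by linarith))
  rw [bernMean_linearStat] at this
  simpa only [sub_zero, ← mul_assoc, show (4 : ℝ) * 2 = 8 by norm_num] using this

theorem inner_centeredMatrix (p : ℝ) (x : Sym2 (Fin N) → Bool) (v : EuclideanSpace ℝ (Fin N)) :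
    inner ℝ (matrixOp (centeredMatrix p x) v) v = linearStat p (fun i j => v i * v j) x := by
  rw [inner_matrixOp]
  rfl

theorem sum_sum_mul_sq (v : EuclideanSpace ℝ (Fin N)) :
    ∑ i, ∑ j, (v i * v j) ^ 2 = ‖v‖ ^ 4 := by
  rw [show ‖v‖ ^ 4 = ‖v‖ ^ 2 * ‖v‖ ^ 2 by ring, EuclideanSpace.real_norm_sq_eq, Finset.sum_mul_sum]
  simp only [mul_pow]

/-- Moving `v` by at most `1/4` changes the quadratic form by at most `(5/16 + 1/4) ‖T‖`, and `15/16
- 5/16 - 1/4 = 3/8`. Thus a near-maximiser comes with a whole ball of vectors on which the form is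
large. -/
theorem abs_inner_ge_of_near {E : Type*} [NormedAddCommGroup E] [InnerProductSpace ℝ E]
    (T : E →L[ℝ] E) {v x : E} (hv : ‖v‖ ≤ 1) (hT : 15 / 16 * ‖T‖ ≤ |inner ℝ (T v) v|)
    (hx : ‖x - v‖ ≤ 1 / 4) : 3 / 8 * ‖T‖ ≤ |inner ℝ (T x) x| := by
  have hxn : ‖x‖ ≤ 5 / 4 := by
    have : x = (x - v) + v := by abel
    rw [this]
    exact (norm_add_le _ _).trans (by linarith)
  have e : inner ℝ (T v) v = inner ℝ (T x) x - inner ℝ (T (x - v)) x - inner ℝ (T v) (x - v) := by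
    rw [map_sub, inner_sub_left, inner_sub_right]
    ring
  have h1 : |inner ℝ (T (x - v)) x| ≤ 5 / 16 * ‖T‖ := by
    refine (abs_real_inner_le_norm _ _).trans ?_
    calc ‖T (x - v)‖ * ‖x‖ ≤ (‖T‖ * ‖x - v‖) * ‖x‖ := by gcongr; exact T.le_opNorm _
      _ ≤ (‖T‖ * (1 / 4)) * (5 / 4) := by gcongr
      _ = _ := by ring
  have h2 : |inner ℝ (T v) (x - v)| ≤ 1 / 4 * ‖T‖ := by
    refine (abs_real_inner_le_norm _ _).trans ?_
    calc ‖T v‖ * ‖x - v‖ ≤ (‖T‖ * ‖v‖) * ‖x - v‖ := by gcongr; exact T.le_opNorm _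
      _ ≤ (‖T‖ * 1) * (1 / 4) := by gcongr
      _ = _ := by ring
  have h3 := abs_sub (inner ℝ (T x) x - inner ℝ (T (x - v)) x) (inner ℝ (T v) (x - v))
  have h4 := abs_sub (inner ℝ (T x) x) (inner ℝ (T (x - v)) x)
  rw [← e] at h3
  linarith

theorem integrableOn_ball_of_continuous {f : EuclideanSpace ℝ (Fin N) → ℝ} (hf : Continuous f)
    (r : ℝ) : IntegrableOn f (Metric.ball 0 r) :=
  (hf.continuousOn.integrableOn_compact (isCompact_closedBall 0 r)).mono_set
    Metric.ball_subset_closedBall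

theorem continuous_linearStat (p : ℝ) (x : Sym2 (Fin N) → Bool) :
    Continuous fun v : EuclideanSpace ℝ (Fin N) => linearStat p (fun i j => v i * v j) x := by
  unfold linearStat
  fun_prop

/-- The exponential moment of the operator norm is controlled by averaging the exponential of the
quadratic form over a ball. -/
theorem exp_norm_mul_volume_le (p : ℝ) (x : Sym2 (Fin N) → Bool) {l : ℝ} (hl : 0 ≤ l) :
    Real.exp (l * (3 / 8 * ‖matrixOp (centeredMatrix p x)‖)) *
        volume.real (Metric.ball (0 : EuclideanSpace ℝ (Fin N)) (1 / 4)) ≤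
      ∫ v in Metric.ball (0 : EuclideanSpace ℝ (Fin N)) (5 / 4),
        (Real.exp (l * linearStat p (fun i j => v i * v j) x) +
          Real.exp (-l * linearStat p (fun i j => v i * v j) x)) := by
  obtain ⟨v, hv, hT⟩ := exists_norm_le_abs_inner (matrixOp (centeredMatrix p x))
    (matrixOp_isSymmetric (centeredMatrix_isHermitian p x))
  have hc := continuous_linearStat p x
  have hint := integrableOn_ball_of_continuous (f := fun v : EuclideanSpace ℝ (Fin N) =>
        (Real.exp (l * linearStat p (fun i j => v i * v j) x) +
          Real.exp (-l * linearStat p (fun i j => v i * v j) x))) (by fun_prop) (5 / 4)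
  -- The near-maximiser `v` depends on `x`, but its ball always lies in this fixed one, so the
  -- integration domain is deterministic.
  have hsub : Metric.ball v (1 / 4) ⊆ Metric.ball (0 : EuclideanSpace ℝ (Fin N)) (5 / 4) := by
    refine Metric.ball_subset_ball' ?_
    rw [dist_zero_right]
    linarith
  refine le_trans ?_ (setIntegral_mono_set hint
    (Filter.Eventually.of_forall fun _ => by positivity) hsub.eventuallyLE)
  rw [Measure.real, ← Measure.addHaar_ball_center volume v (1 / 4), ← Measure.real, mul_comm,
    ← smul_eq_mul, ← setIntegral_const]
  refine setIntegral_mono_on (integrableOn_const (by finiteness)) (hint.mono_set hsub)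
    measurableSet_ball fun y hy => ?_
  have h1 := abs_inner_ge_of_near _ hv hT (x := y) (by
    rw [← dist_eq_norm]
    exact (Metric.mem_ball.1 hy).le)
  rw [inner_centeredMatrix] at h1
  rcases le_abs.1 h1 with h | h
  · have : Real.exp (l * (3 / 8 * ‖matrixOp (centeredMatrix p x)‖)) ≤
        Real.exp (l * linearStat p (fun i j => y i * y j) x) :=
      Real.exp_le_exp.2 (mul_le_mul_of_nonneg_left h hl)
    linarith [Real.exp_pos (-l * linearStat p (fun i j => y i * y j) x)]
  · have : Real.exp (l * (3 / 8 * ‖matrixOp (centeredMatrix p x)‖)) ≤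
        Real.exp (-l * linearStat p (fun i j => y i * y j) x) :=
      Real.exp_le_exp.2 ((mul_le_mul_of_nonneg_left h hl).trans (le_of_eq (by ring)))
    linarith [Real.exp_pos (l * linearStat p (fun i j => y i * y j) x)]

/-- Volume averaging in place of an ε-net. After exchanging mean and integral, each fixed vector
contributes a sub-Gaussian linear statistic. The factor `5 ^ N` is the volume ratio of the balls of
radii `5/4` and `1/4`, and the exponent 5 dominates `2 (5/4)⁴`. -/
theorem bernMean_exp_norm_le {p : ℝ} (hp : p ∈ Set.Icc (0 : ℝ) 1) {l : ℝ} (hl : 0 ≤ l) :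
    bernMean p (fun x : Sym2 (Fin N) → Bool =>
        Real.exp (l * (3 / 8 * ‖matrixOp (centeredMatrix p x)‖))) ≤
      2 * 5 ^ N * Real.exp (5 * l ^ 2) := by
  set V := volume.real (Metric.ball (0 : EuclideanSpace ℝ (Fin N)) (1 / 4)) with hV
  have hVpos : 0 < V := by
    rw [hV, Measure.real]
    exact ENNReal.toReal_pos (Metric.measure_ball_pos _ _ (by norm_num)).ne' (by finiteness)
  have hV5 : volume.real (Metric.ball (0 : EuclideanSpace ℝ (Fin N)) (5 / 4)) = 5 ^ N * V := by
    rw [hV, Measure.real, show (5 / 4 : ℝ) = 5 * (1 / 4) by norm_num,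
      Measure.addHaar_ball_mul_of_pos volume 0 (by norm_num : (0 : ℝ) < 5) (1 / 4),
      ENNReal.toReal_mul, ENNReal.toReal_ofReal (by positivity), finrank_euclideanSpace_fin,
      ← Measure.real]
  refine le_of_mul_le_mul_right ?_ hVpos
  set f : (Sym2 (Fin N) → Bool) → EuclideanSpace ℝ (Fin N) → ℝ := fun x v =>
        (Real.exp (l * linearStat p (fun i j => v i * v j) x) +
          Real.exp (-l * linearStat p (fun i j => v i * v j) x)) with hf
  have hfc : ∀ x, Continuous (f x) := fun x => by
    have := continuous_linearStat p x
    simp only [hf]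
    fun_prop
  calc bernMean p (fun x : Sym2 (Fin N) → Bool =>
        Real.exp (l * (3 / 8 * ‖matrixOp (centeredMatrix p x)‖))) * V
      = bernMean p (fun x : Sym2 (Fin N) → Bool =>
        V * Real.exp (l * (3 / 8 * ‖matrixOp (centeredMatrix p x)‖))) := by
        rw [bernMean_const_mul, mul_comm]
    _ ≤ bernMean p (fun x => ∫ v in Metric.ball (0 : EuclideanSpace ℝ (Fin N)) (5 / 4), f x v) :=
        bernMean_mono hp fun x => by
          rw [mul_comm]
          exact exp_norm_mul_volume_le p x hl
    _ = ∫ v in Metric.ball (0 : EuclideanSpace ℝ (Fin N)) (5 / 4),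
          bernMean p (fun x => f x v) := by
        unfold bernMean
        rw [integral_finsetSum]
        · simp only [integral_const_mul]
        · exact fun x _ => (integrableOn_ball_of_continuous (hfc x) _).const_mul _
    _ ≤ ∫ _ in Metric.ball (0 : EuclideanSpace ℝ (Fin N)) (5 / 4), 2 * Real.exp (5 * l ^ 2) := by
        refine setIntegral_mono_on ?_ (integrableOn_const (by finiteness)) measurableSet_ball
          fun v hv => ?_
        · refine integrableOn_ball_of_continuous ?_ _
          unfold bernMean
          fun_prop
        · have hv4 : ‖v‖ ^ 4 ≤ (5 / 4) ^ 4 := by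
            gcongr
            simpa using (Metric.mem_ball.1 hv).le
          have h1 := bernMean_exp_linearStat_le hp l (fun i j => v i * v j)
          have h2 := bernMean_exp_linearStat_le hp (-l) (fun i j => v i * v j)
          rw [sum_sum_mul_sq] at h1 h2
          rw [neg_sq] at h2
          have h3 : Real.exp (2 * l ^ 2 * ‖v‖ ^ 4) ≤ Real.exp (5 * l ^ 2) :=
            Real.exp_le_exp.2 (by
              have := mul_le_mul_of_nonneg_left hv4 (sq_nonneg l)
              norm_num at this
              nlinarith [sq_nonneg l])
          simp only [hf]
          rw [bernMean_add]
          linarith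
    _ = 2 * 5 ^ N * Real.exp (5 * l ^ 2) * V := by
        rw [setIntegral_const, hV5, smul_eq_mul]
        ring

/-- The centered adjacency matrix has operator norm of order `√N`. -/
theorem bernProb_norm_ge_le {p : ℝ} (hp : p ∈ Set.Icc (0 : ℝ) 1) :
    bernProb p {x : Sym2 (Fin N) → Bool | 32 * √N ≤ ‖matrixOp (centeredMatrix p x)‖} ≤
      2 * Real.exp (-N) := by
  -- With `l = √N` the threshold contributes `√N · (3/8) · 32 √N = 12 N`, against `4N` from `5 ^ N ≤
  -- exp (4N)` and `5N` from the moment bound.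
  have h := bernProb_le_of_le hp (fun x : Sym2 (Fin N) → Bool =>
      √N * (3 / 8 * ‖matrixOp (centeredMatrix p x)‖)) (a := 12 * N)
    {x | 32 * √N ≤ ‖matrixOp (centeredMatrix p x)‖} fun x hx => by
      have hx : 32 * √N ≤ ‖matrixOp (centeredMatrix p x)‖ := hx
      have := mul_le_mul_of_nonneg_left hx (Real.sqrt_nonneg N)
      have h2 := Real.mul_self_sqrt (Nat.cast_nonneg (α := ℝ) N)
      nlinarith
  refine h.trans ((mul_le_mul_of_nonneg_left (bernMean_exp_norm_le hp (Real.sqrt_nonneg _))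
    (Real.exp_pos _).le).trans ?_)
  rw [Real.sq_sqrt (Nat.cast_nonneg _)]
  have h5 : (5 : ℝ) ^ N ≤ Real.exp (4 * N) := by
    rw [mul_comm, Real.exp_nat_mul]
    have : (5 : ℝ) ≤ Real.exp 4 := by linarith [Real.add_one_le_exp (4 : ℝ)]
    gcongr
  calc Real.exp (-(12 * N)) * (2 * 5 ^ N * Real.exp (5 * N))
      ≤ Real.exp (-(12 * N)) * (2 * Real.exp (4 * N) * Real.exp (5 * N)) := by gcongr
    _ = 2 * Real.exp (-(3 * N)) := by
      rw [mul_assoc 2, ← Real.exp_add, mul_left_comm, ← Real.exp_add]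
      congr 2
      ring
    _ ≤ _ := by
      gcongr
      linarith [Nat.cast_nonneg (α := ℝ) N]

end Configuration

/-! ### Typical configurations and the eigenvalue expansion near them. -/

section Expansion

variable {N : ℕ}

/-- The unit vector with constant coordinates. -/
noncomputable def constUnit (N : ℕ) : EuclideanSpace ℝ (Fin N) :=
  WithLp.toLp 2 fun _ => (√N)⁻¹

theorem constUnit_apply (i : Fin N) : constUnit N i = (√N)⁻¹ := rfl

theorem norm_constUnit (hN : 1 ≤ N) : ‖constUnit N‖ = 1 := by
  have hN' : (0 : ℝ) < N := by exact_mod_cast hN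
  rw [EuclideanSpace.norm_eq]
  simp only [constUnit_apply, norm_inv, Real.norm_eq_abs, inv_pow, abs_of_nonneg
    (Real.sqrt_nonneg _), Real.sq_sqrt hN'.le, Finset.sum_const, Finset.card_univ, Fintype.card_fin,
    nsmul_eq_mul]
  rw [mul_inv_cancel₀ hN'.ne', Real.sqrt_one]

/-- The sum of a row of the centered adjacency matrix. -/
def rowStat (p : ℝ) (i : Fin N) (x : Sym2 (Fin N) → Bool) : ℝ := ∑ j, centeredMatrix p x i j

/-- The average of all entries of the centered adjacency matrix, times the number of vertices. -/
noncomputable def meanStat (p : ℝ) (x : Sym2 (Fin N) → Bool) : ℝ :=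
  linearStat p (fun _ _ => (N : ℝ)⁻¹) x

/-- The average of the squared row sums, each one truncated at `N * L ^ 2`. -/
noncomputable def truncStat (L p : ℝ) (x : Sym2 (Fin N) → Bool) : ℝ :=
  (N : ℝ)⁻¹ * ∑ i, min (rowStat p i x ^ 2) (N * L ^ 2)

theorem rowStat_eq_linearStat (p : ℝ) (i : Fin N) (x : Sym2 (Fin N) → Bool) :
    rowStat p i x = linearStat p (fun k _ => if k = i then 1 else 0) x := by
  simp [rowStat, linearStat]

theorem inner_constUnit (p : ℝ) (x : Sym2 (Fin N) → Bool) :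
    inner ℝ (matrixOp (centeredMatrix p x) (constUnit N)) (constUnit N) = meanStat p x := by
  rw [inner_centeredMatrix, meanStat]
  congr 1
  ext i j
  rw [constUnit_apply, constUnit_apply, ← mul_inv, Real.mul_self_sqrt (Nat.cast_nonneg _)]

theorem matrixOp_constUnit_apply (A : Matrix (Fin N) (Fin N) ℝ) (i : Fin N) :
    matrixOp A (constUnit N) i = (∑ j, A i j) * (√N)⁻¹ := by
  rw [matrixOp_apply, Finset.sum_mul]
  rfl

theorem norm_sq_centered_constUnit (p : ℝ) (x : Sym2 (Fin N) → Bool) :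
    ‖matrixOp (centeredMatrix p x) (constUnit N)‖ ^ 2 = (N : ℝ)⁻¹ * ∑ i, rowStat p i x ^ 2 := by
  rw [EuclideanSpace.real_norm_sq_eq, Finset.mul_sum]
  refine Finset.sum_congr rfl fun i _ => ?_
  rw [matrixOp_constUnit_apply, mul_pow, inv_pow, Real.sq_sqrt (Nat.cast_nonneg _), mul_comm]
  rfl

theorem norm_matrixOp_constUnit_le (A : Matrix (Fin N) (Fin N) ℝ) :
    ‖matrixOp A (constUnit N)‖ ≤ (∑ i, ∑ j, |A i j|) * (√N)⁻¹ := by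
  refine (norm_le_sum_abs _).trans ?_
  rw [Finset.sum_mul]
  refine Finset.sum_le_sum fun i _ => ?_
  rw [matrixOp_constUnit_apply, abs_mul, abs_of_nonneg (inv_nonneg.2 (Real.sqrt_nonneg _))]
  exact mul_le_mul_of_nonneg_right (Finset.abs_sum_le_sum_abs _ _)
    (inv_nonneg.2 (Real.sqrt_nonneg _))

theorem matrixOp_configMatrix (hN : 1 ≤ N) (p : ℝ) (x : Sym2 (Fin N) → Bool)
    (v : EuclideanSpace ℝ (Fin N)) :
    matrixOp (configMatrix x) v =
      (N * p * inner ℝ (constUnit N) v) • constUnit N + matrixOp (centeredMatrix p x) v := by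
  have hN' : (0 : ℝ) < N := by exact_mod_cast hN
  ext i
  simp only [PiLp.add_apply, PiLp.smul_apply, matrixOp_apply, constUnit_apply, smul_eq_mul,
    PiLp.inner_apply, RCLike.inner_apply, conj_trivial, configMatrix, centeredMatrix,
    Matrix.of_apply, sub_mul, Finset.sum_sub_distrib, ← Finset.sum_mul, ← Finset.mul_sum]
  have h3 : √(N : ℝ) ≠ 0 := (Real.sqrt_pos.2 hN').ne'
  field_simp
  rw [Real.sq_sqrt hN'.le]
  ring

/-- The truncated square is the square of `min |·| M`, hence Lipschitz with constant `2 * M`. -/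
theorem abs_min_sq_sub_le {M : ℝ} (hM : 0 ≤ M) (a b : ℝ) :
    |min (a ^ 2) (M ^ 2) - min (b ^ 2) (M ^ 2)| ≤ 2 * M * |a - b| := by
  have h : ∀ c : ℝ, min (c ^ 2) (M ^ 2) = min |c| M ^ 2 := by
    intro c
    rcases le_total |c| M with h | h
    · rw [min_eq_left h, min_eq_left, sq_abs]
      rw [← sq_abs]
      gcongr
    · rw [min_eq_right h, min_eq_right]
      rw [← sq_abs c]
      gcongr
  have h1 : |min |a| M - min |b| M| ≤ |a - b| := by
    refine (abs_min_sub_min_le_max _ _ _ _).trans ?_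
    rw [sub_self, abs_zero, max_eq_left (abs_nonneg _)]
    exact abs_abs_sub_abs_le _ _
  have h2 : |min |a| M + min |b| M| ≤ 2 * M := by
    rw [abs_of_nonneg (add_nonneg (le_min (abs_nonneg _) hM) (le_min (abs_nonneg _) hM))]
    linarith [min_le_right |a| M, min_le_right |b| M]
  rw [h, h, sq_sub_sq, abs_mul]
  gcongr

theorem sum_edgeWeight_row_le (e : Sym2 (Fin N)) :
    ∑ i, edgeWeight (fun k _ : Fin N => if k = i then 1 else 0) e ≤ 2 := by
  unfold edgeWeight
  rw [Finset.sum_comm]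
  have : ∀ q : Fin N × Fin N, ∑ i, |(if q.1 = i then 1 else 0 : ℝ)| = 1 := by
    intro q
    rw [Finset.sum_eq_single q.1] <;> simp +contextual [eq_comm]
  simp only [this, Finset.sum_const, nsmul_eq_mul, mul_one]
  exact_mod_cast card_fiber_sym2_mk_le e

/-- This is the purpose of the truncation: squared row sums are then Lipschitz with constant `2 √N
L` instead of order `N`, and one edge moves all row sums by at most 2 in total. -/
theorem abs_truncStat_update_sub_le {L : ℝ} (hL : 0 ≤ L) (hN : 1 ≤ N) (p : ℝ) (e : Sym2 (Fin N))
    (x : Sym2 (Fin N) → Bool) (b : Bool) :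
    |truncStat L p (Function.update x e b) - truncStat L p x| ≤ 4 * L / √N := by
  have hN' : (0 : ℝ) < N := by exact_mod_cast hN
  have hsq : (N : ℝ) * L ^ 2 = (√N * L) ^ 2 := by rw [mul_pow, Real.sq_sqrt hN'.le]
  have h1 : ∀ i, |min (rowStat p i (Function.update x e b) ^ 2) (N * L ^ 2) -
      min (rowStat p i x ^ 2) (N * L ^ 2)| ≤
      2 * (√N * L) * edgeWeight (fun k _ : Fin N => if k = i then 1 else 0) e := by
    intro i
    rw [hsq]
    refine (abs_min_sq_sub_le (by positivity) _ _).trans ?_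
    rw [rowStat_eq_linearStat, rowStat_eq_linearStat]
    exact mul_le_mul_of_nonneg_left (abs_linearStat_update_sub_le _ _ _ _ _) (by positivity)
  unfold truncStat
  rw [← mul_sub, ← Finset.sum_sub_distrib, abs_mul, abs_of_pos (inv_pos.2 hN')]
  calc (N : ℝ)⁻¹ * |∑ i, (min (rowStat p i (Function.update x e b) ^ 2) (N * L ^ 2) -
          min (rowStat p i x ^ 2) (N * L ^ 2))|
      ≤ (N : ℝ)⁻¹ * ∑ i, 2 * (√N * L) *
          edgeWeight (fun k _ : Fin N => if k = i then 1 else 0) e := by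
        gcongr
        exact (Finset.abs_sum_le_sum_abs _ _).trans (Finset.sum_le_sum fun i _ => h1 i)
    _ ≤ (N : ℝ)⁻¹ * (2 * (√N * L) * 2) := by
        rw [← Finset.mul_sum]
        gcongr
        exact sum_edgeWeight_row_le e
    _ = 4 * L / √N := by
        have h2 := Real.mul_self_sqrt hN'.le
        have h3 : √(N : ℝ) ≠ 0 := (Real.sqrt_pos.2 hN').ne'
        field_simp
        nlinarith

theorem card_sym2_fin_le : (Fintype.card (Sym2 (Fin N)) : ℝ) ≤ N ^ 2 := by
  have := Fintype.card_le_of_surjective (fun q : Fin N × Fin N => s(q.1, q.2))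
    Sym2.mk_surjective
  rw [Fintype.card_prod, Fintype.card_fin] at this
  rw [sq]
  exact_mod_cast this

/-- The configurations for which norm, row sums, average and truncated row sums of the centered
adjacency matrix have typical sizes. -/
def goodConfig (L p : ℝ) : Set (Sym2 (Fin N) → Bool) :=
  {x | ‖matrixOp (centeredMatrix p x)‖ ≤ 32 * √N ∧ (∀ i, |rowStat p i x| ≤ √N * L) ∧
    |meanStat p x| ≤ L ∧
    |truncStat L p x - bernMean p (truncStat (N := N) L p)| ≤ √N * L ^ 2}

theorem bernProb_compl_goodConfig_le {L p : ℝ} (hL : 0 < L) (hN : 1 ≤ N)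
    (hp : p ∈ Set.Icc (0 : ℝ) 1) :
    bernProb p (goodConfig (N := N) L p)ᶜ ≤
      2 * Real.exp (-N) + (2 * N + 4) * Real.exp (-(L ^ 2 / 64)) := by
  have hN' : (0 : ℝ) < N := by exact_mod_cast hN
  have hsq := Real.sq_sqrt hN'.le
  have hexp : Real.exp (-(L ^ 2 / 8)) ≤ Real.exp (-(L ^ 2 / 64)) :=
    Real.exp_le_exp.2 (by nlinarith [sq_nonneg L])
  have hsub : (goodConfig (N := N) L p)ᶜ ⊆ {x | 32 * √N ≤ ‖matrixOp (centeredMatrix p x)‖} ∪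
      ((⋃ i, {x | √N * L ≤ |rowStat p i x|}) ∪ ({x | L ≤ |meanStat p x|} ∪
      {x | √N * L ^ 2 ≤ |truncStat L p x - bernMean p (truncStat (N := N) L p)|})) := by
    intro x hx
    by_contra h
    simp only [Set.mem_union, Set.mem_iUnion, Set.mem_ofPred_eq, not_or, not_exists, not_le] at h
    exact hx ⟨h.1.le, fun i => (h.2.1 i).le, h.2.2.1.le, h.2.2.2.le⟩
  have hrow : ∀ i : Fin N, bernProb p {x | √N * L ≤ |rowStat p i x|} ≤
      2 * Real.exp (-(L ^ 2 / 64)) := by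
    intro i
    simp only [rowStat_eq_linearStat]
    refine (bernProb_abs_linearStat_ge_le hp _ hN' (by positivity) ?_).trans ?_
    · rw [Finset.sum_eq_single i] <;> simp +contextual
    · rw [mul_pow, hsq, show (N : ℝ) * L ^ 2 / (8 * N) = L ^ 2 / 8 by field_simp]
      linarith
  have hmean : bernProb p {x : Sym2 (Fin N) → Bool | L ≤ |meanStat p x|} ≤
      2 * Real.exp (-(L ^ 2 / 64)) := by
    refine (bernProb_abs_linearStat_ge_le hp _ one_pos hL.le ?_).trans ?_
    · simp only [Finset.sum_const, Finset.card_univ, Fintype.card_fin, nsmul_eq_mul]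
      field_simp
      exact le_rfl
    · rw [mul_one]
      linarith
  -- At most `N²` edges with differences `4 L / √N` give `V = 16 N L²`, and `(√N L²)² / (4 V) = L² /
  -- 64`; this is the weakest of the exponents in `L`.
  have htrunc : bernProb p {x : Sym2 (Fin N) → Bool | √N * L ^ 2 ≤
      |truncStat L p x - bernMean p (truncStat (N := N) L p)|} ≤ 2 * Real.exp (-(L ^ 2 / 64)) := by
    refine (bernProb_abs_sub_ge_le hp (truncStat L p) (fun _ => 4 * L / √N)
      (fun e x b => abs_truncStat_update_sub_le hL.le hN p e x b) (V := 16 * N * L ^ 2)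
      (by positivity) (by positivity) ?_).trans (le_of_eq ?_)
    · have hc := card_sym2_fin_le (N := N)
      rw [Finset.sum_const, Finset.card_univ, nsmul_eq_mul, div_pow, hsq]
      calc (Fintype.card (Sym2 (Fin N)) : ℝ) * ((4 * L) ^ 2 / N)
          ≤ N ^ 2 * ((4 * L) ^ 2 / N) := by gcongr
        _ = _ := by field_simp; ring
    · rw [mul_pow, hsq]
      congr 3
      field_simp
      norm_num
  refine (bernProb_mono hp hsub).trans ((bernProb_union_le hp _ _).trans ?_)
  have h1 := bernProb_norm_ge_le (N := N) hp
  have h2 := (bernProb_iUnion_le hp (fun i : Fin N => {x | √N * L ≤ |rowStat p i x|})).trans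
    (Finset.sum_le_sum fun i _ => hrow i)
  rw [Finset.sum_const, Finset.card_univ, Fintype.card_fin, nsmul_eq_mul] at h2
  have h3 := bernProb_union_le hp (⋃ i : Fin N, {x | √N * L ≤ |rowStat p i x|})
    ({x | L ≤ |meanStat p x|} ∪
      {x | √N * L ^ 2 ≤ |truncStat L p x - bernMean p (truncStat (N := N) L p)|})
  have h4 := bernProb_union_le hp {x : Sym2 (Fin N) → Bool | L ≤ |meanStat p x|}
      {x | √N * L ^ 2 ≤ |truncStat L p x - bernMean p (truncStat (N := N) L p)|}
  linarith

/-- No row sum reaches the truncation level, so concentration of `truncStat` is concentration of the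
second-order term itself. -/
theorem truncStat_eq_of_good {L p : ℝ} {x : Sym2 (Fin N) → Bool}
    (h : ∀ i, |rowStat p i x| ≤ √N * L) :
    truncStat L p x = ‖matrixOp (centeredMatrix p x) (constUnit N)‖ ^ 2 := by
  rw [norm_sq_centered_constUnit, truncStat]
  congr 1
  refine Finset.sum_congr rfl fun i _ => min_eq_left ?_
  rw [← sq_abs, ← Real.sq_sqrt (Nat.cast_nonneg (α := ℝ) N), ← mul_pow]
  exact pow_le_pow_left₀ (abs_nonneg _) (h i) 2

theorem sum_abs_centeredMatrix_sub_le {p p' d : ℝ} (hd : |p' - p| ≤ d)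
    (x y : Sym2 (Fin N) → Bool) (S : Finset (Sym2 (Fin N))) (hS : ∀ e ∉ S, y e = x e) :
    ∑ i, ∑ j, |(centeredMatrix p' y - centeredMatrix p x) i j| ≤ 2 * S.card + N ^ 2 * d := by
  classical
  have h1 : ∀ i j : Fin N, |(centeredMatrix p' y - centeredMatrix p x) i j| ≤
      (if s(i, j) ∈ S then 1 else 0) + d := by
    intro i j
    have e1 : (centeredMatrix p' y - centeredMatrix p x) i j =
        ((if y s(i, j) then 1 else 0) - (if x s(i, j) then 1 else 0)) - (p' - p) := by
      simp only [centeredMatrix, Matrix.sub_apply, Matrix.of_apply]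
      ring
    rw [e1]
    refine (abs_sub _ _).trans (add_le_add ?_ hd)
    split_ifs with h2 h3 h4 h5 <;> simp_all
  refine (Finset.sum_le_sum fun i _ => Finset.sum_le_sum fun j _ => h1 i j).trans ?_
  simp only [Finset.sum_add_distrib, Finset.sum_const, Finset.card_univ, Fintype.card_fin,
    nsmul_eq_mul]
  refine add_le_add ?_ (le_of_eq (by ring))
  rw [← Fintype.sum_prod_type' (f := fun i j : Fin N => if s(i, j) ∈ S then (1 : ℝ) else 0),
    ← Finset.sum_filter, Finset.sum_const, nsmul_eq_mul, mul_one]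
  have h2 : (Finset.univ.filter fun q : Fin N × Fin N => s(q.1, q.2) ∈ S).card ≤ 2 * S.card := by
    refine Finset.card_le_mul_card_image_of_maps_to (f := fun q : Fin N × Fin N => s(q.1, q.2))
      (fun q hq => (Finset.mem_filter.1 hq).2) 2 fun e _ => ?_
    refine (Finset.card_le_card fun q hq => ?_).trans (card_fiber_sym2_mk_le e)
    simp only [Finset.mem_filter, Finset.mem_univ, true_and] at hq ⊢
    exact hq.2
  exact_mod_cast h2

/-- The three errors are of order `1 / √n`, `L² / n` and `L² / √n`; the fluctuation of the
second-order term dominates. -/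
theorem error_terms_le {n p c L a b : ℝ} (hn : 1 ≤ n) (hL : 1 ≤ L) (hc : 0 < c) (hcp : c ≤ p)
    (hc1 : c ≤ 1) (ha : |a| ≤ 2 * L) (hb : |b| ≤ 66 * (√n * L ^ 2)) :
    10 * ((33 * √n) ^ 3 / (n * p) ^ 2 + a ^ 2 / (n * p)) + |b / (n * p)| ≤
      400000 / c ^ 2 * (L ^ 2 / √n) := by
  set q := √n with hq
  have hq1 : 1 ≤ q := Real.one_le_sqrt.2 hn
  have hq0 : 0 < q := by linarith
  have hnq : n = q ^ 2 := (Real.sq_sqrt (by linarith)).symm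
  have hp0 : 0 < p := by linarith
  have hn0 : 0 < n := by linarith
  have hqle : q ≤ q ^ 2 := by nlinarith
  have hL2 : 1 ≤ L ^ 2 := by nlinarith
  have hcc : 1 / c ≤ 1 / c ^ 2 := by
    gcongr
    nlinarith
  have b1 : (33 * q) ^ 3 / (n * p) ^ 2 ≤ 35937 * (1 / c ^ 2 * (L ^ 2 / q)) := by
    calc (33 * q) ^ 3 / (n * p) ^ 2 ≤ (33 * q) ^ 3 / (n * c) ^ 2 := by gcongr
      _ = 35937 * (1 / c ^ 2 * (1 / q)) := by rw [hnq]; field_simp; norm_num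
      _ ≤ _ := by gcongr
  have b2 : a ^ 2 / (n * p) ≤ 4 * (1 / c ^ 2 * (L ^ 2 / q)) := by
    rw [← sq_abs]
    calc |a| ^ 2 / (n * p) ≤ (2 * L) ^ 2 / (n * c) := by gcongr
      _ = 4 * (1 / c * (L ^ 2 / q ^ 2)) := by rw [hnq]; field_simp; norm_num
      _ ≤ 4 * (1 / c ^ 2 * (L ^ 2 / q)) := by gcongr
  have b3 : |b / (n * p)| ≤ 66 * (1 / c ^ 2 * (L ^ 2 / q)) := by
    rw [abs_div, abs_of_pos (by positivity : 0 < n * p)]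
    calc |b| / (n * p) ≤ (66 * (q * L ^ 2)) / (n * c) := by gcongr
      _ = 66 * (1 / c * (L ^ 2 / q)) := by rw [hnq]; field_simp
      _ ≤ 66 * (1 / c ^ 2 * (L ^ 2 / q)) := by gcongr
  have h0 : 0 ≤ 1 / c ^ 2 * (L ^ 2 / q) := by positivity
  rw [show 400000 / c ^ 2 * (L ^ 2 / q) = 400000 * (1 / c ^ 2 * (L ^ 2 / q)) by ring]
  linarith

/-- Expansion of the principal eigenvalue for configurations that are close to a good one. -/
theorem abs_principalEigenvalue_sub_le_of_good {L p p' d D c : ℝ} (hN : 1 ≤ N) (hL : 1 ≤ L)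
    {x y : Sym2 (Fin N) → Bool} (hx : x ∈ goodConfig L p) (S : Finset (Sym2 (Fin N)))
    (hS : ∀ e ∉ S, y e = x e) (hd : |p' - p| ≤ d) (hD : 2 * S.card + N ^ 2 * d ≤ D)
    (hDN : D ≤ √N) (hc : 0 < c) (hcp : c ≤ p') (hp' : p' ≤ 1) (hNc : 132 * √N ≤ N * c) :
    |principalEigenvalue (configMatrix y) -
        (N * p' + bernMean p (truncStat (N := N) L p) / (N * p')) - meanStat p' y| ≤
      400000 / c ^ 2 * (L ^ 2 / √N) := by
  have hN1 : (1 : ℝ) ≤ N := by exact_mod_cast hN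
  have hN' : (0 : ℝ) < N := by linarith
  set q := √(N : ℝ) with hq
  have hq1 : 1 ≤ q := Real.one_le_sqrt.2 hN1
  have hq0 : 0 < q := by linarith
  have hqq : (N : ℝ) = q ^ 2 := (Real.sq_sqrt hN'.le).symm
  have hp0 : 0 < p' := by linarith
  have hc1 : c ≤ 1 := hcp.trans hp'
  obtain ⟨hx1, hx2, hx3, hx4⟩ := hx
  rw [truncStat_eq_of_good hx2] at hx4
  set m := bernMean p (truncStat (N := N) L p) with hm
  set B := centeredMatrix p' y - centeredMatrix p x with hB
  have hsum := (sum_abs_centeredMatrix_sub_le hd x y S hS).trans hD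
  have hD0 : 0 ≤ D := le_trans (by positivity) hsum
  have hadd : matrixOp (centeredMatrix p' y) = matrixOp (centeredMatrix p x) + matrixOp B := by
    rw [hB, matrixOp, matrixOp, matrixOp, map_sub]
    abel
  have hBn : ‖matrixOp B‖ ≤ D := (norm_matrixOp_le_sum _).trans hsum
  -- The coordinates `1 / √N` of the constant vector turn an entry sum of at most `√N` into a
  -- perturbation of size 1.
  have hBe : ‖matrixOp B (constUnit N)‖ ≤ 1 := by
    refine (norm_matrixOp_constUnit_le _).trans ((mul_le_mul_of_nonneg_right hsum
      (inv_nonneg.2 hq0.le)).trans ?_)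
    rw [← div_eq_mul_inv]
    exact (div_le_one hq0).2 hDN
  have he := norm_constUnit hN
  have hw : ‖matrixOp (centeredMatrix p' y)‖ ≤ 33 * q := by
    rw [hadd]
    exact (norm_add_le _ _).trans (by linarith)
  have hmean : |meanStat p' y| ≤ 2 * L := by
    rw [← inner_constUnit, hadd, add_apply, inner_add_left, inner_constUnit]
    have h1 := abs_real_inner_le_norm (matrixOp B (constUnit N)) (constUnit N)
    rw [he, mul_one] at h1
    exact (abs_add_le _ _).trans (by linarith)
  have hWe : ‖matrixOp (centeredMatrix p x) (constUnit N)‖ ≤ 32 * q := by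
    have := (matrixOp (centeredMatrix p x)).le_opNorm (constUnit N)
    rw [he, mul_one] at this
    exact this.trans hx1
  have hsq : |‖matrixOp (centeredMatrix p' y) (constUnit N)‖ ^ 2 - m| ≤ 66 * (q * L ^ 2) := by
    set a := ‖matrixOp (centeredMatrix p' y) (constUnit N)‖
    set b := ‖matrixOp (centeredMatrix p x) (constUnit N)‖
    have h1 : |a - b| ≤ 1 := by
      refine (abs_norm_sub_norm_le _ _).trans ?_
      rw [hadd, add_apply, add_sub_cancel_left]
      exact hBe
    have hb0 : 0 ≤ b := norm_nonneg _
    have h2 : |a ^ 2 - b ^ 2| ≤ 65 * q := by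
      have ha := abs_le.1 h1
      rw [sq_sub_sq, abs_mul, abs_of_nonneg (add_nonneg (norm_nonneg _) hb0)]
      calc (a + b) * |a - b| ≤ (a + b) * 1 := by gcongr
        _ ≤ 65 * q := by linarith
    have hL2 : 1 ≤ L ^ 2 := by nlinarith
    calc |a ^ 2 - m| = |(a ^ 2 - b ^ 2) + (b ^ 2 - m)| := by congr 1; ring
      _ ≤ |a ^ 2 - b ^ 2| + |b ^ 2 - m| := abs_add_le _ _
      _ ≤ 65 * q + q * L ^ 2 := add_le_add h2 hx4
      _ ≤ _ := by nlinarith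
  have hr : 0 < (N : ℝ) * p' := by positivity
  obtain ⟨v, hv, hev⟩ := exists_principalEigenvector hN (configMatrix_isHermitian y)
  rw [matrixOp_configMatrix hN p'] at hev
  have hlow : N * p' - 33 * q ≤ principalEigenvalue (configMatrix y) := by
    refine le_trans ?_ (inner_matrixOp_le_principalEigenvalue hN (configMatrix_isHermitian y) he)
    rw [matrixOp_configMatrix hN p', inner_add_left, inner_smul_left, real_inner_self_eq_norm_sq,
      he]
    have h1 := abs_real_inner_le_norm (matrixOp (centeredMatrix p' y) (constUnit N)) (constUnit N)
    have h2 := (matrixOp (centeredMatrix p' y)).le_opNorm (constUnit N)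
    rw [he, mul_one] at h1 h2
    have h3 := (abs_le.1 h1).1
    simp only [conj_trivial, one_pow, mul_one]
    linarith
  have hcr : (N : ℝ) * c ≤ N * p' := by gcongr
  -- The gap condition `4 w ≤ r` with `w = 33 √N` is where `132 √N ≤ N c` is needed.
  have main := abs_eigenvalue_sub_expansion_le (matrixOp (centeredMatrix p' y))
    (matrixOp_isSymmetric (centeredMatrix_isHermitian p' y)) he hv hr hw (by linarith) hev hlow
  rw [inner_constUnit] at main
  set X := ‖matrixOp (centeredMatrix p' y) (constUnit N)‖ ^ 2
  set μ := principalEigenvalue (configMatrix y)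
  have hfin : μ - (N * p' + m / (N * p')) - meanStat p' y =
      (μ - N * p' - meanStat p' y - X / (N * p')) + (X - m) / (N * p') := by ring
  rw [hfin]
  exact (abs_add_le _ _).trans ((add_le_add main le_rfl).trans
    (error_terms_le hN1 hL hc hcp hc1 hmean hsq))

end Expansion

/-! ### Transfer from random variables to Bernoulli sums, and Chernoff's bound. -/

section BernoulliVariables

variable {ι : Type*} [Fintype ι] [DecidableEq ι]

/-- Independence makes the joint law a product measure on a finite cube, where each configuration
has mass `bernWeight`. -/
theorem integral_eq_bernMean {Ω : Type*} [MeasurableSpace Ω] {P : Measure Ω}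
    [IsProbabilityMeasure P] {X : ι → Ω → Bool} (hX : ∀ i, Measurable (X i))
    (hind : iIndepFun X P) {p : ℝ} (hp : ∀ i, P.real {ω | X i ω = true} = p)
    (F : (ι → Bool) → ℝ) : ∫ ω, F (fun i => X i ω) ∂P = bernMean p F := by
  have hXm : Measurable fun ω i => X i ω := measurable_pi_iff.2 hX
  have h1 : ∫ ω, F (fun i => X i ω) ∂P = ∫ x, F x ∂(P.map fun ω i => X i ω) :=
    (integral_map hXm.aemeasurable (measurable_of_finite F).aestronglyMeasurable).symm
  have : IsProbabilityMeasure (P.map fun ω i => X i ω) :=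
    Measure.isProbabilityMeasure_map hXm.aemeasurable
  have hXp : ∀ i, IsProbabilityMeasure (P.map (X i)) := fun i =>
    Measure.isProbabilityMeasure_map (hX i).aemeasurable
  have hs : ∀ i b, (P.map (X i)).real {b} = if b then p else 1 - p := by
    have ht : ∀ i, (P.map (X i)).real {true} = p := fun i => by
      rw [map_measureReal_apply (hX i) (measurableSet_singleton _), ← hp i]
      rfl
    intro i b
    cases b
    · have := probReal_compl_eq_one_sub (μ := P.map (X i)) (measurableSet_singleton true)
      rw [ht i] at this
      simpa [Bool.compl_singleton] using this
    · simpa using ht i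
  rw [h1, integral_fintype (Integrable.of_finite), bernMean]
  refine Finset.sum_congr rfl fun x _ => ?_
  rw [smul_eq_mul]
  congr 1
  rw [(iIndepFun_iff_map_fun_eq_pi_map fun i => (hX i).aemeasurable).1 hind, Measure.real,
    Measure.pi_singleton, ENNReal.toReal_prod]
  exact Finset.prod_congr rfl fun i _ => hs i (x i)

theorem measureReal_eq_bernProb {Ω : Type*} [MeasurableSpace Ω] {P : Measure Ω}
    [IsProbabilityMeasure P] {X : ι → Ω → Bool} (hX : ∀ i, Measurable (X i))
    (hind : iIndepFun X P) {p : ℝ} (hp : ∀ i, P.real {ω | X i ω = true} = p)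
    (S : Set (ι → Bool)) : P.real {ω | (fun i => X i ω) ∈ S} = bernProb p S := by
  have hXm : Measurable fun ω i => X i ω := measurable_pi_iff.2 hX
  rw [bernProb, ← integral_eq_bernMean hX hind hp]
  exact (integral_indicator_one (hXm (Set.Finite.measurableSet S.toFinite))).symm

theorem bernMean_exp_card {p : ℝ} :
    bernMean p (fun x : ι → Bool => Real.exp (Finset.univ.filter fun i => x i = true).card) =
      (p * Real.exp 1 + (1 - p)) ^ Fintype.card ι := by
  have h : ∀ x : ι → Bool, bernWeight p x *
      Real.exp (Finset.univ.filter fun i => x i = true).card =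
      ∏ i, (if x i then p * Real.exp 1 else 1 - p) := by
    intro x
    rw [Finset.card_filter, Nat.cast_sum, Real.exp_sum, bernWeight, ← Finset.prod_mul_distrib]
    refine Finset.prod_congr rfl fun i _ => ?_
    cases x i <;> simp
  unfold bernMean
  simp only [h]
  have h2 := Finset.prod_univ_sum (fun _ : ι => (Finset.univ : Finset Bool))
    (fun _ b => if b then p * Real.exp 1 else 1 - p)
  rw [Fintype.piFinset_univ] at h2
  rw [← h2]
  simp

/-- Chernoff's bound for the number of successes. -/
theorem bernProb_card_ge_le {p : ℝ} (hp : p ∈ Set.Icc (0 : ℝ) 1) (m : ℝ) :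
    bernProb p {x : ι → Bool | m ≤ (Finset.univ.filter fun i => x i = true).card} ≤
      Real.exp (-m + 2 * p * Fintype.card ι) := by
  refine (bernProb_le_of_le hp (fun x : ι → Bool =>
    ((Finset.univ.filter fun i => x i = true).card : ℝ)) _ fun x hx => hx).trans ?_
  rw [bernMean_exp_card, Real.exp_add]
  -- Since `e < 3`, the left side is at most `1 + 2p`.
  have h1 : p * Real.exp 1 + (1 - p) ≤ Real.exp (2 * p) := by
    have := Real.add_one_le_exp (2 * p)
    have := mul_le_mul_of_nonneg_left Real.exp_one_lt_three.le hp.1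
    linarith
  have h0 : 0 ≤ p * Real.exp 1 + (1 - p) :=
    add_nonneg (mul_nonneg hp.1 (Real.exp_pos _).le) (sub_nonneg.2 hp.2)
  rw [mul_comm (2 * p), Real.exp_nat_mul]
  gcongr

end BernoulliVariables

/-! ### Exponential holding times. -/

section HoldingTimes

theorem expMeasure_Ioc_le {r : ℝ} (hr : 0 < r) {a b : ℝ} :
    expMeasure r (Set.Ioc a b) ≤ ENNReal.ofReal (r * (b - a)) := by
  change (volume.withDensity (exponentialPDF r)) (Set.Ioc a b) ≤ _
  rw [withDensity_apply _ measurableSet_Ioc]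
  calc ∫⁻ x in Set.Ioc a b, exponentialPDF r x ≤ ∫⁻ _ in Set.Ioc a b, ENNReal.ofReal r := by
        refine lintegral_mono fun x => ?_
        rw [exponentialPDF_eq]
        refine ENNReal.ofReal_le_ofReal ?_
        split_ifs with hx
        · have : Real.exp (-(r * x)) ≤ 1 := Real.exp_le_one_iff.2 (by nlinarith)
          nlinarith
        · exact hr.le
    _ = ENNReal.ofReal (r * (b - a)) := by
        rw [setLIntegral_const, Real.volume_Ioc, ENNReal.ofReal_mul hr.le]

theorem expMeasure_Iic {r : ℝ} (hr : 0 < r) {t : ℝ} (ht : 0 ≤ t) :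
    expMeasure r (Set.Iic t) = ENNReal.ofReal (1 - Real.exp (-(r * t))) := by
  have := isProbabilityMeasure_expMeasure hr
  rw [← ofReal_cdf, cdf_expMeasure_eq hr, if_pos ht]

theorem expMeasure_Iio_zero {r : ℝ} (hr : 0 < r) : expMeasure r (Set.Iio 0) = 0 := by
  have := isProbabilityMeasure_expMeasure hr
  refine measure_mono_null Set.Iio_subset_Iic_self ?_
  rw [expMeasure_Iic hr le_rfl]
  simp

variable {Ω : Type*} [MeasurableSpace Ω] {P : Measure Ω} [IsProbabilityMeasure P]

/-- If an independent exponential time is added to `Y`, the sum is unlikely to fall in a short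
interval. -/
theorem measure_add_mem_Ioc_le {r : ℝ} (hr : 0 < r) {Y Z : Ω → ℝ} (hY : Measurable Y)
    (hZ : Measurable Z) (hYZ : IndepFun Y Z P) (hlaw : P.map Z = expMeasure r) (a b : ℝ) :
    P {ω | Y ω + Z ω ∈ Set.Ioc a b} ≤ ENNReal.ofReal (r * (b - a)) * P {ω | Y ω ≤ b} := by
  have := isProbabilityMeasure_expMeasure hr
  have hYp : IsProbabilityMeasure (P.map Y) := Measure.isProbabilityMeasure_map hY.aemeasurable
  have hm : MeasurableSet {q : ℝ × ℝ | q.1 + q.2 ∈ Set.Ioc a b} :=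
    (measurable_fst.add measurable_snd) measurableSet_Ioc
  have h1 : P {ω | Y ω + Z ω ∈ Set.Ioc a b} =
      ((P.map Y).prod (expMeasure r)) {q : ℝ × ℝ | q.1 + q.2 ∈ Set.Ioc a b} := by
    rw [← hlaw, ← (indepFun_iff_map_prod_eq_prod_map_map hY.aemeasurable hZ.aemeasurable).1 hYZ,
      Measure.map_apply (hY.prodMk hZ) hm]
    rfl
  rw [h1, Measure.prod_apply hm]
  calc ∫⁻ y, expMeasure r (Prod.mk y ⁻¹' {q : ℝ × ℝ | q.1 + q.2 ∈ Set.Ioc a b}) ∂(P.map Y)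
      ≤ ∫⁻ y, (Set.Iic b).indicator (fun _ => ENNReal.ofReal (r * (b - a))) y ∂(P.map Y) := by
        refine lintegral_mono fun y => ?_
        -- For `y > b` a negative holding time would be needed. The factor `P {Y ≤ b}` gained here
        -- makes the bounds summable over cycles.
        by_cases hy : y ∈ Set.Iic b
        · rw [Set.indicator_of_mem hy]
          refine (measure_mono fun z hz => ?_).trans
            ((expMeasure_Ioc_le hr (a := a - y) (b := b - y)).trans_eq (by congr 2; ring))
          have hz : y + z ∈ Set.Ioc a b := hz
          exact ⟨by linarith [hz.1], by linarith [hz.2]⟩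
        · rw [Set.indicator_of_notMem hy]
          refine le_of_eq (measure_mono_null (fun z hz => ?_) (expMeasure_Iio_zero hr))
          have hz : y + z ∈ Set.Ioc a b := hz
          have hy : b < y := not_le.1 hy
          change z < 0
          linarith [hz.2]
    _ = ENNReal.ofReal (r * (b - a)) * P {ω | Y ω ≤ b} := by
        rw [lintegral_indicator_const measurableSet_Iic, Measure.map_apply hY measurableSet_Iic]
        rfl

end HoldingTimes

/-! ### Independence and identical distribution of the edge inputs. -/

section EdgeInput

variable {Ω : Type*} {N : ℕ}

/-- All the randomness attached to the edge `e`: its initial state and its holding times. -/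
def edgeInput (init : Sym2 (Fin N) → Ω → Bool) (ξ : Bool → Sym2 (Fin N) → ℕ → Ω → ℝ)
    (e : Sym2 (Fin N)) : Option (Bool × ℕ) → Ω → ℝ
  | none => fun ω => ((init e ω).toNat : ℝ)
  | some (b, l) => ξ b e l

variable [MeasurableSpace Ω] {P : Measure Ω} {p₀ lon loff : ℝ}
  {init : Sym2 (Fin N) → Ω → Bool} {ξ : Bool → Sym2 (Fin N) → ℕ → Ω → ℝ}

theorem IsOnOffInput.measurable_edgeInput (h : IsOnOffInput P p₀ lon loff init ξ)
    (e : Sym2 (Fin N)) (k : Option (Bool × ℕ)) : Measurable (edgeInput init ξ e k) := by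
  rcases k with _ | ⟨b, l⟩
  · exact (measurable_from_top (f := fun b : Bool => (b.toNat : ℝ))).comp (h.measurable_init e)
  · exact h.measurable_time b e l

theorem IsOnOffInput.iIndepFun_edgeInput_pair (h : IsOnOffInput P p₀ lon loff init ξ) :
    iIndepFun (fun q : Sym2 (Fin N) × Option (Bool × ℕ) => edgeInput init ξ q.1 q.2) P := by
  let g : Sym2 (Fin N) × Option (Bool × ℕ) → Sym2 (Fin N) ⊕ (Bool × Sym2 (Fin N) × ℕ) := fun q =>
    match q.2 with
    | none => Sum.inl q.1
    | some (b, l) => Sum.inr (b, q.1, l)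
  have hg : Function.Injective g := by
    rintro ⟨e, _ | ⟨b, l⟩⟩ ⟨e', _ | ⟨b', l'⟩⟩ hq <;> simp_all [g]
  have := h.indep.precomp hg
  convert! this using 1
  ext ⟨e, _ | ⟨b, l⟩⟩ <;> rfl

theorem IsOnOffInput.iIndepFun_edgeInput_single (h : IsOnOffInput P p₀ lon loff init ξ)
    (e : Sym2 (Fin N)) : iIndepFun (edgeInput init ξ e) P :=
  h.iIndepFun_edgeInput_pair.precomp (g := fun k => (e, k)) fun _ _ hk => (Prod.ext_iff.1 hk).2

variable [IsProbabilityMeasure P]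

/-- Grouping independent variables into blocks: the joint law is an infinite product over pairs, and
currying turns it into a product over edges of the laws of their inputs. -/
theorem IsOnOffInput.iIndepFun_edgeInput (h : IsOnOffInput P p₀ lon loff init ξ) :
    iIndepFun (fun (e : Sym2 (Fin N)) ω k => edgeInput init ξ e k ω) P := by
  have hm := h.measurable_edgeInput
  have hp : ∀ e k, IsProbabilityMeasure (P.map (edgeInput init ξ e k)) := fun e k =>
    Measure.isProbabilityMeasure_map (hm e k).aemeasurable
  rw [iIndepFun_iff_map_fun_eq_infinitePi_map fun e => measurable_pi_iff.2 (hm e)]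
  have h1 := h.iIndepFun_edgeInput_pair.map_fun_eq_infinitePi_map
    fun q : Sym2 (Fin N) × Option (Bool × ℕ) => hm q.1 q.2
  have h2 : ∀ e, P.map (fun ω k => edgeInput init ξ e k ω) =
      Measure.infinitePi fun k => P.map (edgeInput init ξ e k) := fun e =>
    (h.iIndepFun_edgeInput_single e).map_fun_eq_infinitePi_map (hm e)
  simp only [h2]
  rw [← Measure.infinitePi_map_curry fun e k => P.map (edgeInput init ξ e k), ← h1,
    Measure.map_map (by fun_prop)
      (measurable_pi_iff.2 fun q : Sym2 (Fin N) × Option (Bool × ℕ) => hm q.1 q.2)]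
  rfl

theorem IsOnOffInput.map_edgeInput_eq (h : IsOnOffInput P p₀ lon loff init ξ)
    (e e' : Sym2 (Fin N)) :
    P.map (fun ω k => edgeInput init ξ e k ω) = P.map (fun ω k => edgeInput init ξ e' k ω) := by
  rw [(h.iIndepFun_edgeInput_single e).map_fun_eq_infinitePi_map (h.measurable_edgeInput e),
    (h.iIndepFun_edgeInput_single e').map_fun_eq_infinitePi_map (h.measurable_edgeInput e')]
  congr 1
  ext1 k
  rcases k with _ | ⟨b, l⟩
  · have hb : P.map (init e) = P.map (init e') := by
      have ht : ∀ e, P.map (init e) {true} = ENNReal.ofReal p₀ := fun e => by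
        rw [Measure.map_apply (h.measurable_init e) (measurableSet_singleton _), ← h.law_init e]
        rfl
      have hf : ∀ e, P.map (init e) {false} = 1 - ENNReal.ofReal p₀ := fun e => by
        have := Measure.isProbabilityMeasure_map (h.measurable_init e).aemeasurable (μ := P)
        have h1 := prob_compl_eq_one_sub (μ := P.map (init e)) (measurableSet_singleton true)
        rw [ht] at h1
        rw [← h1, Bool.compl_singleton]
        rfl
      refine Measure.ext_of_singleton fun b => ?_
      cases b
      · rw [hf, hf]
      · rw [ht, ht]
    have hm : ∀ e, P.map (edgeInput init ξ e none) =
        (P.map (init e)).map fun b : Bool => (b.toNat : ℝ) := fun e => by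
      rw [Measure.map_map measurable_from_top (h.measurable_init e)]
      rfl
    rw [hm, hm, hb]
  · cases b
    · exact (h.law_off e l).trans (h.law_off e' l).symm
    · exact (h.law_on e l).trans (h.law_on e' l).symm

end EdgeInput

/-! ### Edge states and switches as measurable functions of the input. -/

section EdgeState

theorem measurable_cycleTime {Ω : Type*} [MeasurableSpace Ω] {ξ : Bool → ℕ → Ω → ℝ}
    (h : ∀ b l, Measurable (ξ b l)) (k : ℕ) :
    Measurable fun ω => cycleTime (fun b l => ξ b l ω) k := by
  unfold cycleTime
  fun_prop

theorem onOffState_eq_zero_or_one (b : Bool) (ξ : Bool → ℕ → ℝ) (t : ℝ) :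
    onOffState b ξ t = 0 ∨ onOffState b ξ t = 1 := by
  unfold onOffState
  split_ifs <;> simp

theorem measurable_onOffState {Ω : Type*} [MeasurableSpace Ω] {ξ : Bool → ℕ → Ω → ℝ}
    (h : ∀ b l, Measurable (ξ b l)) (b : Bool) (t : ℝ) :
    Measurable fun ω => onOffState b (fun b l => ξ b l ω) t := by
  unfold onOffState
  refine Measurable.ite ?_ measurable_const measurable_const
  rw [Set.ofPred_exists]
  refine MeasurableSet.iUnion fun k => ?_
  have h1 := measurable_cycleTime h k
  exact (measurableSet_le h1 measurable_const).inter
    (measurableSet_lt measurable_const (h1.add (h b k)))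

/-- The set of holding times for which some end of an on- or off-period, whatever the initial state,
falls into `(s, t]`. -/
def switchSet (s t : ℝ) : Set (Bool → ℕ → ℝ) :=
  {ξ | ∃ k, cycleTime ξ (k + 1) ∈ Set.Ioc s t ∨ ∃ b, cycleTime ξ k + ξ b k ∈ Set.Ioc s t}

/-- The state depends on time only through comparisons with the period endpoints, and these agree at
`s` and `t` when no endpoint lies between. Positivity of the holding times plays no role. -/
theorem onOffState_eq_of_notMem_switchSet {s t t' : ℝ} (hs : 0 ≤ s) {ξ : Bool → ℕ → ℝ}
    (h : ξ ∉ switchSet s t') (hst : s ≤ t) (htt' : t ≤ t') (b : Bool) :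
    onOffState b ξ t = onOffState b ξ s := by
  have h1 : ∀ k, cycleTime ξ k ∉ Set.Ioc s t' := by
    -- The cycle time of index 0 is 0, which `0 ≤ s` keeps out of the interval; hence `switchSet`
    -- only lists `k + 1`.
    rintro (_ | k) hk
    · simp only [cycleTime, Finset.range_zero, Finset.sum_empty, add_zero, Set.mem_Ioc] at hk
      linarith
    · exact h ⟨k, Or.inl hk⟩
  have h2 : ∀ k, cycleTime ξ k + ξ b k ∉ Set.Ioc s t' := fun k hk => h ⟨k, Or.inr ⟨b, hk⟩⟩
  have h3 : ∀ c : ℝ, c ∉ Set.Ioc s t' → (c ≤ t ↔ c ≤ s) := fun c hc =>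
    ⟨fun hct => not_lt.1 fun hsc => hc ⟨hsc, hct.trans htt'⟩, fun hcs => hcs.trans hst⟩
  have h4 : ∀ k, t ∈ Set.Ico (cycleTime ξ k) (cycleTime ξ k + ξ b k) ↔
      s ∈ Set.Ico (cycleTime ξ k) (cycleTime ξ k + ξ b k) := fun k => by
    rw [Set.mem_Ico, Set.mem_Ico, h3 _ (h1 k), ← not_le, ← not_le, h3 _ (h2 k)]
  unfold onOffState
  by_cases hc : ∃ k, s ∈ Set.Ico (cycleTime ξ k) (cycleTime ξ k + ξ b k)
  · rw [if_pos hc, if_pos ((exists_congr h4).2 hc)]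
  · rw [if_neg hc, if_neg fun h => hc ((exists_congr h4).1 h)]

variable {Ω : Type*} {N : ℕ}

/-- The state of the edge `e` at time `t`. -/
noncomputable def edgeState (init : Sym2 (Fin N) → Ω → Bool)
    (ξ : Bool → Sym2 (Fin N) → ℕ → Ω → ℝ) (t : ℝ) (e : Sym2 (Fin N)) (ω : Ω) : Bool :=
  decide (edgeProcess init ξ e t ω = 1)

theorem edgeProcess_eq_ite (init : Sym2 (Fin N) → Ω → Bool)
    (ξ : Bool → Sym2 (Fin N) → ℕ → Ω → ℝ) (t : ℝ) (e : Sym2 (Fin N)) (ω : Ω) :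
    edgeProcess init ξ e t ω = if edgeState init ξ t e ω then 1 else 0 := by
  rcases onOffState_eq_zero_or_one (init e ω) (fun b l => ξ b e l ω) t with h | h <;>
    simp [edgeState, edgeProcess, h]

theorem adjacencyProcess_eq_configMatrix (init : Sym2 (Fin N) → Ω → Bool)
    (ξ : Bool → Sym2 (Fin N) → ℕ → Ω → ℝ) (t : ℝ) (ω : Ω) :
    adjacencyProcess init ξ t ω = configMatrix fun e => edgeState init ξ t e ω := by
  ext i j
  exact edgeProcess_eq_ite init ξ t s(i, j) ω

open Classical in
/-- Whether the edge `e` may switch during `(s, t]`. -/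
noncomputable def edgeSwitch (ξ : Bool → Sym2 (Fin N) → ℕ → Ω → ℝ) (s t : ℝ)
    (e : Sym2 (Fin N)) (ω : Ω) : Bool :=
  decide ((fun b l => ξ b e l ω) ∈ switchSet s t)

theorem edgeState_eq_of_edgeSwitch (init : Sym2 (Fin N) → Ω → Bool)
    (ξ : Bool → Sym2 (Fin N) → ℕ → Ω → ℝ) {s t t' : ℝ} (hs : 0 ≤ s) (hst : s ≤ t) (htt' : t ≤ t')
    {e : Sym2 (Fin N)} {ω : Ω} (h : edgeSwitch ξ s t' e ω = false) :
    edgeState init ξ t e ω = edgeState init ξ s e ω := by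
  have h' : (fun b l => ξ b e l ω) ∉ switchSet s t' := by simpa [edgeSwitch] using h
  unfold edgeState edgeProcess
  rw [onOffState_eq_of_notMem_switchSet hs h' hst htt']

/-- The state of an edge as a function of its input. -/
noncomputable def stateOfInput (t : ℝ) (z : Option (Bool × ℕ) → ℝ) : Bool :=
  decide ((if z none = 1 then onOffState true (fun b l => z (some (b, l))) t
    else onOffState false (fun b l => z (some (b, l))) t) = 1)

theorem measurable_stateOfInput (t : ℝ) : Measurable (stateOfInput t) := by
  refine measurable_to_bool ?_
  have h : ∀ (b : Bool) (l : ℕ), Measurable fun z : Option (Bool × ℕ) → ℝ => z (some (b, l)) :=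
    fun b l => measurable_pi_apply _
  have h0 : Measurable fun z : Option (Bool × ℕ) → ℝ =>
      if z none = 1 then onOffState true (fun b l => z (some (b, l))) t
        else onOffState false (fun b l => z (some (b, l))) t :=
    Measurable.ite ((measurable_pi_apply none) (measurableSet_singleton 1))
      (measurable_onOffState h true t) (measurable_onOffState h false t)
  have : stateOfInput t ⁻¹' {true} = {z : Option (Bool × ℕ) → ℝ |
      (if z none = 1 then onOffState true (fun b l => z (some (b, l))) t
        else onOffState false (fun b l => z (some (b, l))) t) = 1} := by
    ext z
    simp [stateOfInput]
  rw [this]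
  exact h0 (measurableSet_singleton 1)

open Classical in
/-- Whether an edge may switch during `(s, t]`, as a function of its input. -/
noncomputable def switchOfInput (s t : ℝ) (z : Option (Bool × ℕ) → ℝ) : Bool :=
  decide ((fun b l => z (some (b, l))) ∈ switchSet s t)

theorem measurable_switchOfInput (s t : ℝ) : Measurable (switchOfInput s t) := by
  refine measurable_to_bool ?_
  have h : ∀ (b : Bool) (l : ℕ), Measurable fun z : Option (Bool × ℕ) → ℝ => z (some (b, l)) :=
    fun b l => measurable_pi_apply _
  have : switchOfInput s t ⁻¹' {true} = ⋃ k, ({z : Option (Bool × ℕ) → ℝ |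
      cycleTime (fun b l => z (some (b, l))) (k + 1) ∈ Set.Ioc s t} ∪
      ⋃ b, {z : Option (Bool × ℕ) → ℝ |
        cycleTime (fun b l => z (some (b, l))) k + z (some (b, k)) ∈ Set.Ioc s t}) := by
    ext z
    simp only [switchOfInput, Set.mem_preimage, Set.mem_singleton_iff, decide_eq_true_eq,
      Set.mem_iUnion, Set.mem_union]
    exact Iff.rfl
  rw [this]
  refine MeasurableSet.iUnion fun k => MeasurableSet.union ?_ (MeasurableSet.iUnion fun b => ?_)
  · exact measurable_cycleTime h (k + 1) measurableSet_Ioc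
  · exact ((measurable_cycleTime h k).add (h b k)) measurableSet_Ioc

theorem edgeState_eq_stateOfInput (init : Sym2 (Fin N) → Ω → Bool)
    (ξ : Bool → Sym2 (Fin N) → ℕ → Ω → ℝ) (t : ℝ) (e : Sym2 (Fin N)) (ω : Ω) :
    edgeState init ξ t e ω = stateOfInput t fun k => edgeInput init ξ e k ω := by
  unfold edgeState edgeProcess stateOfInput edgeInput
  cases h : init e ω <;> simp [h]

variable [MeasurableSpace Ω] {P : Measure Ω} {p₀ lon loff : ℝ}
  {init : Sym2 (Fin N) → Ω → Bool} {ξ : Bool → Sym2 (Fin N) → ℕ → Ω → ℝ}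

theorem IsOnOffInput.measurable_comp_edgeInput (h : IsOnOffInput P p₀ lon loff init ξ)
    {f : (Option (Bool × ℕ) → ℝ) → Bool} (hf : Measurable f) (e : Sym2 (Fin N)) :
    Measurable fun ω => f fun k => edgeInput init ξ e k ω :=
  hf.comp (measurable_pi_iff.2 (h.measurable_edgeInput e))

theorem IsOnOffInput.measurable_edgeState (h : IsOnOffInput P p₀ lon loff init ξ) (t : ℝ)
    (e : Sym2 (Fin N)) : Measurable (edgeState init ξ t e) := by
  rw [funext (edgeState_eq_stateOfInput init ξ t e)]
  exact h.measurable_comp_edgeInput (measurable_stateOfInput t) e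

theorem IsOnOffInput.measurable_edgeSwitch (h : IsOnOffInput P p₀ lon loff init ξ) (s t : ℝ)
    (e : Sym2 (Fin N)) : Measurable (edgeSwitch ξ s t e) :=
  h.measurable_comp_edgeInput (measurable_switchOfInput s t) e

theorem edgeProb_eq (e : Sym2 (Fin N)) (t : ℝ) :
    edgeProb P init ξ e t = P.real {ω | edgeState init ξ t e ω = true} := by
  simp [edgeProb, edgeState]

variable [IsProbabilityMeasure P]

theorem IsOnOffInput.measureReal_comp_edgeInput_eq (h : IsOnOffInput P p₀ lon loff init ξ)
    {f : (Option (Bool × ℕ) → ℝ) → Bool} (hf : Measurable f) (e e' : Sym2 (Fin N)) :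
    P.real {ω | f (fun k => edgeInput init ξ e k ω) = true} =
      P.real {ω | f (fun k => edgeInput init ξ e' k ω) = true} := by
  have h1 : ∀ e, P.real {ω | f (fun k => edgeInput init ξ e k ω) = true} =
      (P.map fun ω k => edgeInput init ξ e k ω).real (f ⁻¹' {true}) := fun e => by
    rw [map_measureReal_apply (measurable_pi_iff.2 (h.measurable_edgeInput e))
      (hf (measurableSet_singleton _))]
    rfl
  rw [h1, h1, h.map_edgeInput_eq e e']

theorem IsOnOffInput.iIndepFun_edgeState (h : IsOnOffInput P p₀ lon loff init ξ) (t : ℝ) :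
    iIndepFun (edgeState init ξ t) P := by
  have := h.iIndepFun_edgeInput.comp (fun _ => stateOfInput t) fun _ => measurable_stateOfInput t
  convert! this using 1
  ext e ω
  exact edgeState_eq_stateOfInput init ξ t e ω

theorem IsOnOffInput.iIndepFun_edgeSwitch (h : IsOnOffInput P p₀ lon loff init ξ) (s t : ℝ) :
    iIndepFun (edgeSwitch ξ s t) P :=
  h.iIndepFun_edgeInput.comp (fun _ => switchOfInput s t) fun _ => measurable_switchOfInput s t

theorem IsOnOffInput.edgeProb_congr (h : IsOnOffInput P p₀ lon loff init ξ) (e e' : Sym2 (Fin N))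
    (t : ℝ) : edgeProb P init ξ e t = edgeProb P init ξ e' t := by
  rw [edgeProb_eq, edgeProb_eq]
  simp only [edgeState_eq_stateOfInput]
  exact h.measureReal_comp_edgeInput_eq (measurable_stateOfInput t) e e'

theorem IsOnOffInput.abs_edgeProb_sub_le (h : IsOnOffInput P p₀ lon loff init ξ)
    (e : Sym2 (Fin N)) {s t t' : ℝ} (hs : 0 ≤ s) (hst : s ≤ t) (htt' : t ≤ t') :
    |edgeProb P init ξ e t - edgeProb P init ξ e s| ≤
      P.real {ω | edgeSwitch ξ s t' e ω = true} := by
  rw [edgeProb_eq, edgeProb_eq]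
  refine (abs_measureReal_sub_le_measureReal_symmDiff
    (h.measurable_edgeState t e (measurableSet_singleton true)).nullMeasurableSet
    (h.measurable_edgeState s e (measurableSet_singleton true)).nullMeasurableSet).trans
    (measureReal_mono ?_)
  intro ω hω
  by_contra hc
  have h1 := edgeState_eq_of_edgeSwitch init ξ hs hst htt' (Bool.eq_false_iff.2 hc)
  simp [Set.mem_symmDiff, h1] at hω

end EdgeState

/-! ### Probability of a switch in a short interval. -/

section SwitchProbability

variable {Ω : Type*} [MeasurableSpace Ω] {P : Measure Ω}
  {ζ : Bool → ℕ → Ω → ℝ} {r : Bool → ℝ}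

theorem ae_nonneg_of_map_eq_expMeasure (hm : ∀ b l, Measurable (ζ b l)) (hr : ∀ b, 0 < r b)
    (hlaw : ∀ b l, P.map (ζ b l) = expMeasure (r b)) : ∀ᵐ ω ∂P, ∀ b l, 0 ≤ ζ b l ω := by
  rw [ae_all_iff]
  intro b
  rw [ae_all_iff]
  intro l
  have h : P (ζ b l ⁻¹' Set.Iio 0) = 0 := by
    rw [← Measure.map_apply (hm b l) measurableSet_Iio, hlaw]
    exact expMeasure_Iio_zero (hr b)
  refine measure_mono_null (fun ω hω => ?_) h
  have hω : ¬ 0 ≤ ζ b l ω := hω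
  exact not_le.1 hω

theorem cycleTime_eq_sum (ξ : Bool → ℕ → ℝ) (k : ℕ) :
    cycleTime ξ k = ∑ q ∈ Finset.univ ×ˢ Finset.range k, ξ q.1 q.2 := by
  rw [Finset.sum_product, Fintype.sum_bool, cycleTime, add_comm]

/-- If `k` cycles fit into `[0, t]`, each of the `k` independent on-times is at most `t`; this gives
geometric decay in `k`. -/
theorem measure_cycleTime_le (hind : iIndepFun (fun q : Bool × ℕ => ζ q.1 q.2) P)
    (hm : ∀ b l, Measurable (ζ b l)) (hr : ∀ b, 0 < r b)
    (hlaw : ∀ b l, P.map (ζ b l) = expMeasure (r b)) {t : ℝ} (ht : 0 ≤ t) (k : ℕ) :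
    P {ω | cycleTime (fun b l => ζ b l ω) k ≤ t} ≤
      ENNReal.ofReal (1 - Real.exp (-(r true * t))) ^ k := by
  have hind' : iIndepFun (ζ true) P :=
    hind.precomp (g := fun l => (true, l)) fun _ _ hk => (Prod.ext_iff.1 hk).2
  calc P {ω | cycleTime (fun b l => ζ b l ω) k ≤ t}
      ≤ P (⋂ l ∈ Finset.range k, ζ true l ⁻¹' Set.Iic t) := by
        refine measure_mono_ae ?_
        filter_upwards [ae_nonneg_of_map_eq_expMeasure hm hr hlaw] with ω hω hc
        refine Set.mem_iInter₂.2 fun l hl => le_trans ?_ hc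
        refine (Finset.single_le_sum (f := fun l => ζ true l ω) (fun l _ => hω true l) hl).trans ?_
        exact le_add_of_nonneg_left (Finset.sum_nonneg fun l _ => hω false l)
    _ = ∏ l ∈ Finset.range k, P (ζ true l ⁻¹' Set.Iic t) :=
        hind'.measure_inter_preimage_eq_mul (Finset.range k) fun _ _ => measurableSet_Iic
    _ = _ := by
        rw [Finset.prod_congr rfl fun l _ => ?_, Finset.prod_const, Finset.card_range]
        rw [← Measure.map_apply (hm true l) measurableSet_Iic, hlaw, expMeasure_Iic (hr true) ht]

variable [IsProbabilityMeasure P]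

/-- Each endpoint is an independent exponential time added to something at least as large as the
preceding cycle time, so it lies in `(s, t]` with probability at most `c * ρ ^ k`. There are three
kinds of endpoint per cycle, and the geometric series sums to `exp (r true * t)`. -/
theorem measure_switchSet_le (hind : iIndepFun (fun q : Bool × ℕ => ζ q.1 q.2) P)
    (hm : ∀ b l, Measurable (ζ b l)) (hr : ∀ b, 0 < r b)
    (hlaw : ∀ b l, P.map (ζ b l) = expMeasure (r b)) {s t : ℝ} (hs : 0 ≤ s) (hst : s ≤ t) :
    P {ω | (fun b l => ζ b l ω) ∈ switchSet s t} ≤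
      ENNReal.ofReal (3 * (r false + r true) * Real.exp (r true * t) * (t - s)) := by
  set ρ := ENNReal.ofReal (1 - Real.exp (-(r true * t))) with hρ
  set c := ENNReal.ofReal ((r false + r true) * (t - s)) with hc
  have hsum0 : ∀ k, ∑ q ∈ Finset.univ ×ˢ Finset.range k, ζ q.1 q.2 =
      fun ω => cycleTime (fun b l => ζ b l ω) k := fun k => by
    ext ω
    rw [Finset.sum_apply, cycleTime_eq_sum]
  have hTm : ∀ k, Measurable fun ω => cycleTime (fun b l => ζ b l ω) k := measurable_cycleTime hm
  have hrc : ∀ b, ENNReal.ofReal (r b * (t - s)) ≤ c := fun b => by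
    refine ENNReal.ofReal_le_ofReal (mul_le_mul_of_nonneg_right ?_ (sub_nonneg.2 hst))
    cases b <;> linarith [hr false, hr true]
  have h1 : ∀ k b, P {ω | cycleTime (fun b l => ζ b l ω) k + ζ b k ω ∈ Set.Ioc s t} ≤
      c * ρ ^ k := fun k b => by
    have hi := hind.indepFun_finsetSum_of_notMem (fun q => hm q.1 q.2)
      (s := Finset.univ ×ˢ Finset.range k) (i := (b, k)) (by simp)
    rw [hsum0] at hi
    exact (measure_add_mem_Ioc_le (hr b) (hTm k) (hm b k) hi (hlaw b k) s t).trans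
      (mul_le_mul' (hrc b) (measure_cycleTime_le hind hm hr hlaw (hs.trans hst) k))
  have h2 : ∀ k, P {ω | cycleTime (fun b l => ζ b l ω) (k + 1) ∈ Set.Ioc s t} ≤ c * ρ ^ k := by
    intro k
    -- The end of a full cycle is split as its last on-time plus the rest, namely the preceding
    -- cycles and the last off-time.
    have hi := hind.indepFun_finsetSum_of_notMem (fun q => hm q.1 q.2)
      (s := insert (false, k) (Finset.univ ×ˢ Finset.range k)) (i := (true, k)) (by simp)
    rw [Finset.sum_insert (by simp), hsum0] at hi
    have h3 := measure_add_mem_Ioc_le (hr true) ((hm false k).add (hTm k)) (hm true k) hi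
      (hlaw true k) s t
    have h4 : ∀ ω, cycleTime (fun b l => ζ b l ω) (k + 1) =
        (ζ false k + fun ω => cycleTime (fun b l => ζ b l ω) k) ω + ζ true k ω := fun ω => by
      simp only [cycleTime, Finset.sum_range_succ, Pi.add_apply]
      ring
    simp only [h4]
    refine h3.trans (mul_le_mul' (hrc true) (le_trans (measure_mono_ae ?_)
      (measure_cycleTime_le hind hm hr hlaw (hs.trans hst) k)))
    filter_upwards [ae_nonneg_of_map_eq_expMeasure hm hr hlaw] with ω hω hY
    have hY : ζ false k ω + cycleTime (fun b l => ζ b l ω) k ≤ t := hY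
    change cycleTime (fun b l => ζ b l ω) k ≤ t
    linarith [hω false k]
  have hset : {ω | (fun b l => ζ b l ω) ∈ switchSet s t} =
      ⋃ k, ({ω | cycleTime (fun b l => ζ b l ω) (k + 1) ∈ Set.Ioc s t} ∪
        ({ω | cycleTime (fun b l => ζ b l ω) k + ζ false k ω ∈ Set.Ioc s t} ∪
        {ω | cycleTime (fun b l => ζ b l ω) k + ζ true k ω ∈ Set.Ioc s t})) := by
    ext ω
    simp only [switchSet, Set.mem_ofPred_eq, Bool.exists_bool, Set.mem_iUnion, Set.mem_union]
  have hρ1 : 1 - ρ = ENNReal.ofReal (Real.exp (-(r true * t))) := by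
    rw [hρ, ← ENNReal.ofReal_one, ← ENNReal.ofReal_sub, sub_sub_cancel]
    exact sub_nonneg.2 (Real.exp_le_one_iff.2
      (neg_nonpos.2 (mul_nonneg (hr true).le (hs.trans hst))))
  rw [hset]
  calc _ ≤ ∑' k, (c * ρ ^ k + (c * ρ ^ k + c * ρ ^ k)) := by
        refine (measure_iUnion_le _).trans (ENNReal.tsum_le_tsum fun k => ?_)
        exact (measure_union_le _ _).trans (add_le_add (h2 k)
          ((measure_union_le _ _).trans (add_le_add (h1 k false) (h1 k true))))
    _ = ∑' k, (3 * c) * ρ ^ k := by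
        congr 1
        ext k
        ring
    _ = 3 * c * (1 - ρ)⁻¹ := by rw [ENNReal.tsum_mul_left, ENNReal.tsum_geometric]
    _ = _ := by
        rw [hρ1, ← ENNReal.ofReal_inv_of_pos (Real.exp_pos _), ← Real.exp_neg, neg_neg, hc,
          ← ENNReal.ofReal_ofNat 3, ← ENNReal.ofReal_mul (by norm_num), ← ENNReal.ofReal_mul]
        · congr 1
          ring
        · exact mul_nonneg (by norm_num)
            (mul_nonneg (add_nonneg (hr _).le (hr _).le) (sub_nonneg.2 hst))

end SwitchProbability

/-! ### Switching rate and lower bound for the edge probability. -/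

section EdgeBounds

variable {Ω : Type*} {N : ℕ} [MeasurableSpace Ω] {P : Measure Ω} [IsProbabilityMeasure P]
  {p₀ lon loff : ℝ} {init : Sym2 (Fin N) → Ω → Bool} {ξ : Bool → Sym2 (Fin N) → ℕ → Ω → ℝ}

theorem IsOnOffInput.measureReal_edgeSwitch_le (h : IsOnOffInput P p₀ lon loff init ξ)
    (hlon : 0 < lon) (hloff : 0 < loff) {s t : ℝ} (hs : 0 ≤ s) (hst : s ≤ t) (e : Sym2 (Fin N)) :
    P.real {ω | edgeSwitch ξ s t e ω = true} ≤
      3 * (loff + lon) * Real.exp (lon * t) * (t - s) := by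
  have hind : iIndepFun (fun q : Bool × ℕ => ξ q.1 e q.2) P := by
    have := (h.iIndepFun_edgeInput_single e).precomp (g := some) (Option.some_injective _)
    exact this
  have h1 := measure_switchSet_le (ζ := fun b l => ξ b e l) (r := fun b => if b then lon else loff)
    hind (fun b l => h.measurable_time b e l) (fun b => by cases b <;> simpa)
    (fun b l => by
      cases b
      · simpa using h.law_off e l
      · simpa using h.law_on e l) hs hst
  have h2 : {ω | edgeSwitch ξ s t e ω = true} = {ω | (fun b l => ξ b e l ω) ∈ switchSet s t} := by
    ext ω
    simp [edgeSwitch]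
  rw [h2, Measure.real]
  refine ENNReal.toReal_le_of_le_ofReal ?_ (by simpa using h1)
  have := sub_nonneg.2 hst
  positivity

/-- An edge that starts present and whose first on-time exceeds `t` is still present. This keeps `N
p(t)` of order `N` on all of `[0, T]`. -/
theorem IsOnOffInput.le_edgeProb (h : IsOnOffInput P p₀ lon loff init ξ) (hp₀ : 0 ≤ p₀)
    (hlon : 0 < lon) {t : ℝ} (ht : 0 ≤ t) (e : Sym2 (Fin N)) :
    p₀ * Real.exp (-(lon * t)) ≤ edgeProb P init ξ e t := by
  have hind : IndepFun (edgeInput init ξ e none) (edgeInput init ξ e (some (true, 0))) P :=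
    (h.iIndepFun_edgeInput_single e).indepFun (by simp)
  have hexp := isProbabilityMeasure_expMeasure hlon
  have h1 := hind.measure_inter_preimage_eq_mul {1} (Set.Ioi t) (measurableSet_singleton _)
    measurableSet_Ioi
  have h2 : edgeInput init ξ e none ⁻¹' {1} = {ω | init e ω = true} := by
    ext ω
    cases hi : init e ω <;> simp [edgeInput, hi]
  have h3 : P (edgeInput init ξ e (some (true, 0)) ⁻¹' Set.Ioi t) =
      ENNReal.ofReal (Real.exp (-(lon * t))) := by
    rw [show edgeInput init ξ e (some (true, 0)) = ξ true e 0 from rfl,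
      ← Measure.map_apply (h.measurable_time true e 0) measurableSet_Ioi, h.law_on, ← Set.compl_Iic,
      prob_compl_eq_one_sub measurableSet_Iic, expMeasure_Iic hlon ht, ← ENNReal.ofReal_one,
      ← ENNReal.ofReal_sub, sub_sub_cancel]
    exact sub_nonneg.2 (Real.exp_le_one_iff.2 (neg_nonpos.2 (mul_nonneg hlon.le ht)))
  rw [h2, h3, h.law_init, ← ENNReal.ofReal_mul hp₀] at h1
  rw [edgeProb, Measure.real]
  refine (ENNReal.ofReal_le_iff_le_toReal (by finiteness)).1 (h1.symm.le.trans (measure_mono ?_))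
  rintro ω ⟨hi, hξ⟩
  have hi : init e ω = true := hi
  have hξ : t < ξ true e 0 ω := hξ
  change onOffState _ _ _ = 1
  unfold onOffState
  rw [hi, if_pos ⟨0, by simp [cycleTime, ht, hξ]⟩]
  rfl

end EdgeBounds

/-! ### Uniformity in time and centring at the expectation. -/

section GoodEvent

variable {N : ℕ}

theorem abs_centeredMatrix_le {p : ℝ} (hp : p ∈ Set.Icc (0 : ℝ) 1) (x : Sym2 (Fin N) → Bool)
    (i j : Fin N) : |centeredMatrix p x i j| ≤ 1 := by
  simp only [centeredMatrix, Matrix.of_apply]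
  rw [abs_le]
  constructor <;> split_ifs <;> linarith [hp.1, hp.2]

theorem abs_meanStat_le {p : ℝ} (hp : p ∈ Set.Icc (0 : ℝ) 1) (x : Sym2 (Fin N) → Bool) :
    |meanStat p x| ≤ N := by
  unfold meanStat linearStat
  simp only [← Finset.sum_mul]
  rw [abs_mul, abs_of_nonneg (show 0 ≤ (N : ℝ)⁻¹ by positivity)]
  have h : |∑ i, ∑ j, centeredMatrix p x i j| ≤ N * N := by
    refine (Finset.abs_sum_le_sum_abs _ _).trans ?_
    refine (Finset.sum_le_card_nsmul _ _ (N : ℝ) fun i _ => ?_).trans_eq (by simp)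
    refine (Finset.abs_sum_le_sum_abs _ _).trans ?_
    exact (Finset.sum_le_card_nsmul _ _ (1 : ℝ) fun j _ => abs_centeredMatrix_le hp x i j).trans_eq
      (by simp)
  refine (mul_le_mul_of_nonneg_right h (inv_nonneg.2 (Nat.cast_nonneg N))).trans_eq ?_
  rcases Nat.eq_zero_or_pos N with rfl | hN
  · simp
  · field_simp

theorem abs_principalEigenvalue_configMatrix_le (hN : 1 ≤ N) (x : Sym2 (Fin N) → Bool) :
    |principalEigenvalue (configMatrix x)| ≤ N ^ 2 := by
  refine (abs_principalEigenvalue_le hN (configMatrix_isHermitian x)).trans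
    ((norm_matrixOp_le_sum _).trans ?_)
  refine (Finset.sum_le_card_nsmul _ _ (N : ℝ) fun i _ => ?_).trans_eq (by simp [sq])
  refine (Finset.sum_le_card_nsmul _ _ (1 : ℝ) fun j _ => ?_).trans_eq (by simp)
  simp only [configMatrix, Matrix.of_apply]
  split_ifs <;> simp

theorem bernMean_truncStat_mem (hN : 1 ≤ N) {L p : ℝ} (hp : p ∈ Set.Icc (0 : ℝ) 1) :
    bernMean p (truncStat (N := N) L p) ∈ Set.Icc 0 (N * L ^ 2) := by
  have hN' : (0 : ℝ) < N := by exact_mod_cast hN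
  constructor
  · rw [← bernMean_const (ι := Sym2 (Fin N)) p 0]
    refine bernMean_mono hp fun x => mul_nonneg (inv_nonneg.2 hN'.le)
      (Finset.sum_nonneg fun i _ => le_min (sq_nonneg _) (by positivity))
  · rw [← bernMean_const (ι := Sym2 (Fin N)) p (N * L ^ 2)]
    refine bernMean_mono hp fun x => ?_
    have h : ∑ i, min (rowStat p i x ^ 2) (N * L ^ 2) ≤ N * (N * L ^ 2) :=
      (Finset.sum_le_card_nsmul _ _ _ fun i _ => min_le_right _ _).trans_eq (by simp)
    calc (N : ℝ)⁻¹ * ∑ i, min (rowStat p i x ^ 2) (N * L ^ 2)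
        ≤ (N : ℝ)⁻¹ * (N * (N * L ^ 2)) := by gcongr
      _ = N * L ^ 2 := by field_simp

theorem exists_grid_point {T t : ℝ} (hT : 0 < T) (ht : t ∈ Set.Icc 0 T) {n : ℕ} (hn : 1 ≤ n) :
    ∃ k ≤ n, k * (T / n) ≤ t ∧ t ≤ k * (T / n) + T / n := by
  have hn' : (0 : ℝ) < n := by exact_mod_cast hn
  have hδ : 0 < T / n := by positivity
  refine ⟨⌊t / (T / n)⌋₊, Nat.floor_le_of_le ?_, ?_, ?_⟩
  · rw [div_le_iff₀ hδ]
    refine ht.2.trans_eq ?_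
    field_simp
  · rw [← le_div_iff₀ hδ]
    exact Nat.floor_le (div_nonneg ht.1 hδ.le)
  · have := (div_lt_iff₀ hδ).1 (Nat.lt_floor_add_one (t / (T / n)))
    linarith

variable {Ω : Type*} [MeasurableSpace Ω] {P : Measure Ω} [IsProbabilityMeasure P]
  {p₀ lon loff : ℝ} {init : Sym2 (Fin N) → Ω → Bool} {ξ : Bool → Sym2 (Fin N) → ℕ → Ω → ℝ}

/-- Outside an event of small probability, the principal eigenvalue of the dynamic graph is
approximated by its fluctuating linear part plus a deterministic function of time. -/
theorem IsOnOffInput.exists_event_expansion (h : IsOnOffInput P p₀ lon loff init ξ)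
    (hN : 1 ≤ N) (hp₀ : p₀ ∈ Set.Ioo (0 : ℝ) 1) (hlon : 0 < lon) (hloff : 0 < loff) {T L c C : ℝ}
    (hT : 0 < T) (hL : 1 ≤ L) (hc : c = p₀ * Real.exp (-(lon * T)))
    (hC : C = 3 * (loff + lon) * Real.exp (lon * (2 * T)))
    (hD : 2 * L ^ 2 + C * T ≤ √N) (hNc : 132 * √N ≤ N * c) {p : ℝ → ℝ}
    (hp : ∀ e t, edgeProb P init ξ e t = p t) :
    ∃ E : Set Ω, MeasurableSet E ∧
      P.real Eᶜ ≤ (N ^ 2 + 1) * (2 * Real.exp (-N) + (2 * N + 4) * Real.exp (-(L ^ 2 / 64)) +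
        Real.exp (-L ^ 2 + 2 * (C * T))) ∧
      ∃ m : ℝ → ℝ, ∀ t ∈ Set.Icc 0 T, |m t| ≤ N + L ^ 2 / c ∧ ∀ ω ∈ E,
        |principalEigenvalue (configMatrix fun e => edgeState init ξ t e ω) - m t -
          meanStat (p t) (fun e => edgeState init ξ t e ω)| ≤ 400000 / c ^ 2 * (L ^ 2 / √N) := by
  have hN' : (0 : ℝ) < N := by exact_mod_cast hN
  have hn : 1 ≤ N ^ 2 := Nat.one_le_pow _ _ hN
  set e₀ : Sym2 (Fin N) := s(⟨0, hN⟩, ⟨0, hN⟩) with he₀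
  have hc0 : 0 < c := by rw [hc]; exact mul_pos hp₀.1 (Real.exp_pos _)
  have hC0 : 0 < C := by rw [hC]; positivity
  have hpI : ∀ t, p t ∈ Set.Icc (0 : ℝ) 1 := fun t => by
    rw [← hp e₀]
    exact ⟨measureReal_nonneg, measureReal_le_one⟩
  have hps : ∀ t e, P.real {ω | edgeState init ξ t e ω = true} = p t := fun t e => by
    rw [← edgeProb_eq, hp]
  -- With this mesh the expected number of switching edges per interval is at most `C * T`, whatever
  -- `N` is.
  set δ : ℝ := T / (N ^ 2 : ℕ) with hδ
  have hδ0 : 0 < δ := by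
    have : (0 : ℝ) < (N ^ 2 : ℕ) := by exact_mod_cast hn
    positivity
  have hδT : δ ≤ T := div_le_self hT.le (by exact_mod_cast hn)
  have hkT : ∀ k ≤ N ^ 2, k * δ ≤ T := fun k hk => by
    rw [hδ, ← mul_div_assoc, div_le_iff₀ (by exact_mod_cast hn), mul_comm T]
    gcongr
  -- The grid point `k = N ^ 2` covers `t = T`; its interval runs past `T` but stays below `2T`,
  -- hence the `2 * T` in `C`.
  have hsw : ∀ k ≤ N ^ 2, ∀ e, P.real {ω | edgeSwitch ξ (k * δ) (k * δ + δ) e ω = true} ≤ C * δ :=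
    fun k hk e => by
      refine (h.measureReal_edgeSwitch_le hlon hloff (by positivity) (by linarith) e).trans ?_
      rw [hC, add_sub_cancel_left]
      gcongr
      linarith [hkT k hk]
  have hNδ : (N : ℝ) ^ 2 * δ = T := by
    rw [hδ]
    push_cast
    field_simp
  let A : ℕ → Set Ω := fun k => {ω | (fun e => edgeState init ξ (k * δ) e ω) ∈
    (goodConfig L (p (k * δ)))ᶜ}
  let B : ℕ → Set Ω := fun k => {ω | (fun e => edgeSwitch ξ (k * δ) (k * δ + δ) e ω) ∈
    {x : Sym2 (Fin N) → Bool | L ^ 2 ≤ (Finset.univ.filter fun e => x e = true).card}}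
  have hA : ∀ k, P.real (A k) ≤
      2 * Real.exp (-N) + (2 * N + 4) * Real.exp (-(L ^ 2 / 64)) := fun k => by
    refine (measureReal_eq_bernProb (h.measurable_edgeState _) (h.iIndepFun_edgeState _)
      (hps _) _).trans_le ?_
    exact bernProb_compl_goodConfig_le (by linarith) hN (hpI _)
  have hB : ∀ k ≤ N ^ 2, P.real (B k) ≤ Real.exp (-L ^ 2 + 2 * (C * T)) := fun k hk => by
    set β := P.real {ω | edgeSwitch ξ (k * δ) (k * δ + δ) e₀ ω = true} with hβ
    have hβe : ∀ e, P.real {ω | edgeSwitch ξ (k * δ) (k * δ + δ) e ω = true} = β := fun e =>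
      h.measureReal_comp_edgeInput_eq (measurable_switchOfInput _ _) e e₀
    refine (measureReal_eq_bernProb (h.measurable_edgeSwitch _ _) (h.iIndepFun_edgeSwitch _ _)
      hβe _).trans_le ((bernProb_card_ge_le ⟨measureReal_nonneg, measureReal_le_one⟩ _).trans ?_)
    refine Real.exp_le_exp.2 (add_le_add le_rfl ?_)
    calc 2 * β * (Fintype.card (Sym2 (Fin N)) : ℝ) ≤ 2 * (C * δ) * N ^ 2 := by
          gcongr
          · exact hsw k hk e₀
          · exact card_sym2_fin_le
      _ = 2 * (C * T) := by rw [← hNδ]; ring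
  have hmA : ∀ k, MeasurableSet (A k) := fun k =>
    measurable_pi_iff.2 (h.measurable_edgeState (k * δ)) (Set.toFinite _).measurableSet
  have hmB : ∀ k, MeasurableSet (B k) := fun k =>
    measurable_pi_iff.2 (h.measurable_edgeSwitch (k * δ) (k * δ + δ)) (Set.toFinite _).measurableSet
  refine ⟨(⋃ k ∈ Finset.range (N ^ 2 + 1), (A k ∪ B k))ᶜ,
    (Finset.measurableSet_biUnion _ fun k _ => (hmA k).union (hmB k)).compl, ?_, ?_⟩
  · rw [compl_compl]
    refine (measureReal_biUnion_finset_le _ _).trans ?_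
    refine (Finset.sum_le_card_nsmul _ _ (2 * Real.exp (-N) + (2 * N + 4) *
      Real.exp (-(L ^ 2 / 64)) + Real.exp (-L ^ 2 + 2 * (C * T))) fun k hk => ?_).trans_eq ?_
    · exact (measureReal_union_le _ _).trans (add_le_add (hA k)
        (hB k (Nat.lt_succ_iff.1 (Finset.mem_range.1 hk))))
    · rw [Finset.card_range, nsmul_eq_mul]
      push_cast
      ring
  have hgrid : ∀ t ∈ Set.Icc 0 T, ∃ k ≤ N ^ 2, k * δ ≤ t ∧ t ≤ k * δ + δ := fun t ht =>
    exists_grid_point hT ht hn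
  choose! κ hκ using hgrid
  -- The second-order term is centred at the density of the grid point `κ t * δ`. Any deterministic
  -- choice will do, as it is later replaced by the expectation.
  refine ⟨fun t => N * p t + bernMean (p (κ t * δ)) (truncStat (N := N) L (p (κ t * δ))) /
    (N * p t), fun t ht => ?_⟩
  obtain ⟨hκ1, hκ2, hκ3⟩ := hκ t ht
  have hcp : c ≤ p t := by
    rw [← hp e₀, hc]
    refine le_trans ?_ (h.le_edgeProb hp₀.1.le hlon ht.1 e₀)
    have := ht.2
    have := hp₀.1
    gcongr
  constructor
  · obtain ⟨hm0, hm1⟩ := bernMean_truncStat_mem hN (L := L) (hpI (κ t * δ))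
    have hpt : 0 < p t := hc0.trans_le hcp
    rw [abs_of_nonneg (by positivity)]
    refine add_le_add (mul_le_of_le_one_right hN'.le (hpI t).2) ?_
    calc bernMean (p (κ t * δ)) (truncStat (N := N) L (p (κ t * δ))) / (N * p t)
        ≤ N * L ^ 2 / (N * c) := by gcongr
      _ = L ^ 2 / c := by field_simp
  · intro ω hω
    have hω' : ω ∉ A (κ t) ∪ B (κ t) := fun hc' => hω (Set.mem_biUnion
      (Finset.mem_coe.2 (Finset.mem_range.2 (Nat.lt_succ_iff.2 hκ1))) hc')
    rw [Set.mem_union, not_or] at hω'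
    have hx : (fun e => edgeState init ξ (κ t * δ) e ω) ∈ goodConfig L (p (κ t * δ)) :=
      not_not.1 hω'.1
    have hcard : ((Finset.univ.filter fun e : Sym2 (Fin N) =>
        edgeSwitch ξ (κ t * δ) (κ t * δ + δ) e ω = true).card : ℝ) ≤ L ^ 2 :=
      (not_le.1 hω'.2).le
    refine abs_principalEigenvalue_sub_le_of_good hN hL hx
      (Finset.univ.filter fun e => edgeSwitch ξ (κ t * δ) (κ t * δ + δ) e ω = true)
      (fun e he => ?_) (d := C * δ) ?_ (D := 2 * L ^ 2 + C * T) ?_ hD hc0 hcp (hpI t).2 hNc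
    · refine edgeState_eq_of_edgeSwitch init ξ (by positivity) hκ2 hκ3 (Bool.eq_false_iff.2 ?_)
      simpa using he
    · rw [← hp e₀, ← hp e₀]
      exact (h.abs_edgeProb_sub_le e₀ (by positivity) hκ2 hκ3).trans (hsw _ hκ1 e₀)
    · rw [← mul_assoc, mul_right_comm, hNδ, mul_comm T]
      linarith

/-- Outside an event of small probability, the principal eigenvalue of the dynamic graph is
approximated by its expectation plus its linear part. -/
theorem IsOnOffInput.exists_event_concentration (h : IsOnOffInput P p₀ lon loff init ξ)
    (hN : 1 ≤ N) (hp₀ : p₀ ∈ Set.Ioo (0 : ℝ) 1) (hlon : 0 < lon) (hloff : 0 < loff)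
    {T L c C ε : ℝ}
    (hT : 0 < T) (hL : 1 ≤ L) (hc : c = p₀ * Real.exp (-(lon * T)))
    (hC : C = 3 * (loff + lon) * Real.exp (lon * (2 * T)))
    (hD : 2 * L ^ 2 + C * T ≤ √N) (hNc : 132 * √N ≤ N * c) {p : ℝ → ℝ}
    (hp : ∀ e t, edgeProb P init ξ e t = p t)
    (hε : (N ^ 2 + 1) * (2 * Real.exp (-N) + (2 * N + 4) * Real.exp (-(L ^ 2 / 64)) +
        Real.exp (-L ^ 2 + 2 * (C * T))) ≤ ε) (hε' : 4 * N ^ 2 / c * ε ≤ L ^ 2 / √N) :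
    ∃ E : Set Ω, MeasurableSet E ∧ P.real Eᶜ ≤ ε ∧ ∀ t ∈ Set.Icc 0 T, ∀ ω ∈ E,
        |principalEigenvalue (configMatrix fun e => edgeState init ξ t e ω) -
          ∫ ω', principalEigenvalue (configMatrix fun e => edgeState init ξ t e ω') ∂P -
          meanStat (p t) (fun e => edgeState init ξ t e ω)| ≤
          (800000 / c ^ 2 + 1) * (L ^ 2 / √N) := by
  obtain ⟨E, hE, hPE, m, hm⟩ := h.exists_event_expansion hN hp₀ hlon hloff hT hL hc hC hD hNc hp
  have hPE' := hPE.trans hε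
  refine ⟨E, hE, hPE', fun t ht ω hω => ?_⟩
  obtain ⟨hmt, hmE⟩ := hm t ht
  have hN1 : (1 : ℝ) ≤ N := by exact_mod_cast hN
  have hc0 : 0 < c := by rw [hc]; exact mul_pos hp₀.1 (Real.exp_pos _)
  have hc1 : c ≤ 1 := by
    rw [hc]
    exact mul_le_one₀ hp₀.2.le (Real.exp_pos _).le
      (Real.exp_le_one_iff.2 (neg_nonpos.2 (mul_nonneg hlon.le hT.le)))
  set e₀ : Sym2 (Fin N) := s(⟨0, hN⟩, ⟨0, hN⟩) with he₀
  have hpI : p t ∈ Set.Icc (0 : ℝ) 1 := by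
    rw [← hp e₀]
    exact ⟨measureReal_nonneg, measureReal_le_one⟩
  set K := 400000 / c ^ 2 * (L ^ 2 / √N) with hK
  have hXm : Measurable fun ω e => edgeState init ξ t e ω :=
    measurable_pi_iff.2 (h.measurable_edgeState t)
  set F : (Sym2 (Fin N) → Bool) → ℝ := fun x => principalEigenvalue (configMatrix x) - m t -
    meanStat (p t) x with hF
  have hFb : ∀ x, |F x| ≤ 4 * N ^ 2 / c := fun x => by
    have h1 := abs_principalEigenvalue_configMatrix_le hN x
    have h2 := abs_meanStat_le hpI x
    have h3 := (abs_sub (principalEigenvalue (configMatrix x) - m t) (meanStat (p t) x)).trans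
      (add_le_add_left (abs_sub _ _) _)
    have h4 : L ^ 2 ≤ N ^ 2 := by
      have hC0 : 0 < C := by rw [hC]; positivity
      have : √(N : ℝ) ≤ N := Real.sqrt_le_iff.2 ⟨by linarith, by nlinarith⟩
      nlinarith [mul_pos hC0 hT, sq_nonneg L]
    have h5 : (N : ℝ) ≤ N ^ 2 := by nlinarith
    have h6 : (N : ℝ) ^ 2 ≤ N ^ 2 / c := by
      rw [le_div_iff₀ hc0]
      exact mul_le_of_le_one_right (by positivity) hc1
    have h7 : L ^ 2 / c ≤ N ^ 2 / c := by gcongr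
    have h8 : 4 * (N : ℝ) ^ 2 / c = 4 * (N ^ 2 / c) := by ring
    rw [h8]
    linarith
  have hFE : ∀ ω ∈ E, |F fun e => edgeState init ξ t e ω| ≤ K := hmE
  have hint : ∀ f : (Sym2 (Fin N) → Bool) → ℝ,
      Integrable (fun ω => f fun e => edgeState init ξ t e ω) P := fun f =>
    (Integrable.of_finite (μ := P.map fun ω e => edgeState init ξ t e ω)).comp_measurable hXm
  have hmean0 : ∫ ω, meanStat (p t) (fun e => edgeState init ξ t e ω) ∂P = 0 := by
    rw [integral_eq_bernMean (h.measurable_edgeState t) (h.iIndepFun_edgeState t) (p := p t)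
      (fun e => by rw [← edgeProb_eq, hp]) (meanStat (p t))]
    exact bernMean_linearStat _ _
  -- Integrating the remainder `F`: the linear part vanishes, `E` contributes at most `K`, and `Eᶜ`
  -- at most its probability times `4 N² / c`.
  have hcenter : |∫ ω, principalEigenvalue (configMatrix fun e => edgeState init ξ t e ω) ∂P -
      m t| ≤ K + L ^ 2 / √N := by
    have h1 : ∫ ω, F (fun e => edgeState init ξ t e ω) ∂P =
        ∫ ω, principalEigenvalue (configMatrix fun e => edgeState init ξ t e ω) ∂P - m t := by
      simp only [hF]
      rw [integral_sub (hint fun x => principalEigenvalue (configMatrix x) - m t)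
        (hint (meanStat (p t))), hmean0, sub_zero,
        integral_sub (hint fun x => principalEigenvalue (configMatrix x)) (integrable_const _)]
      simp
    rw [← h1]
    have hK0 : 0 ≤ K := by positivity
    have h2 : ∀ ω, ‖F fun e => edgeState init ξ t e ω‖ ≤
        K + Eᶜ.indicator (fun _ => 4 * (N : ℝ) ^ 2 / c) ω := fun ω => by
      rw [Real.norm_eq_abs]
      by_cases hω : ω ∈ E
      · rw [Set.indicator_of_notMem (not_not.2 hω), add_zero]
        exact hFE ω hω
      · rw [Set.indicator_of_mem hω]
        exact (hFb _).trans (le_add_of_nonneg_left hK0)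
    have h3 : Integrable (Eᶜ.indicator fun _ : Ω => 4 * (N : ℝ) ^ 2 / c) P :=
      (integrable_const _).indicator hE.compl
    have h4 := norm_integral_le_of_norm_le ((integrable_const K).add h3)
      (Filter.Eventually.of_forall h2)
    refine h4.trans ?_
    simp only [Pi.add_apply]
    rw [integral_add (integrable_const K) h3, integral_indicator_const _ hE.compl]
    simp only [integral_const, probReal_univ, one_mul, smul_eq_mul]
    refine add_le_add le_rfl (le_trans ?_ hε')
    rw [mul_comm]
    gcongr
  have hfin : principalEigenvalue (configMatrix fun e => edgeState init ξ t e ω) -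
      ∫ ω', principalEigenvalue (configMatrix fun e => edgeState init ξ t e ω') ∂P -
      meanStat (p t) (fun e => edgeState init ξ t e ω) =
      (F fun e => edgeState init ξ t e ω) -
      (∫ ω', principalEigenvalue (configMatrix fun e => edgeState init ξ t e ω') ∂P - m t) := by
    simp only [hF]
    ring
  rw [hfin]
  refine (abs_sub _ _).trans ((add_le_add (hFE ω hω) hcenter).trans_eq ?_)
  rw [hK]
  ring

end GoodEvent

/-! ### Comparison of powers of `N` with `exp (-c (log N)²)`. -/

section Asymptotics

open Filter

theorem tendsto_log_natCast_atTop : Tendsto (fun N : ℕ => Real.log N) atTop atTop :=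
  Real.tendsto_log_atTop.comp tendsto_natCast_atTop_atTop

theorem eventually_log_sq_add_le_sqrt (a : ℝ) :
    ∀ᶠ N : ℕ in atTop, 2 * Real.log N ^ 2 + a ≤ √N := by
  have hs : Tendsto (fun N : ℕ => √(N : ℝ)) atTop atTop :=
    Real.tendsto_sqrt_atTop.comp tendsto_natCast_atTop_atTop
  have h1 := ((Real.isLittleO_pow_log_id_atTop (n := 2)).comp_tendsto hs).bound
    (show (0 : ℝ) < 1 / 16 by norm_num)
  filter_upwards [h1, hs.eventually_ge_atTop (2 * a)] with N h2 h3
  simp only [Function.comp_apply, id_eq, Real.norm_eq_abs, abs_of_nonneg (Real.sqrt_nonneg _)] at h2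
  rw [Real.log_sqrt (Nat.cast_nonneg N), abs_of_nonneg (sq_nonneg _)] at h2
  linarith

/-- In exponential form, a constant times `N³` is absorbed by `exp ((log N)² / 128)`. This halves
the exponent `1/64` to `1/128` in the failure probability, and also handles the contribution of the
bad event to the mean. -/
theorem eventually_add_mul_log_le (a : ℝ) :
    ∀ᶠ N : ℕ in atTop, a + 3 * Real.log N ≤ Real.log N ^ 2 / 128 := by
  filter_upwards [tendsto_log_natCast_atTop.eventually_ge_atTop (128 * (3 + |a|)),
    tendsto_log_natCast_atTop.eventually_ge_atTop 1] with N h1 h2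
  have h3 := mul_le_mul_of_nonneg_right h1 (by linarith : 0 ≤ Real.log N)
  have h4 := mul_le_mul_of_nonneg_left h2 (abs_nonneg a)
  have h5 := le_abs_self a
  nlinarith

theorem eventually_failure_bound_le (a : ℝ) :
    ∀ᶠ N : ℕ in atTop, ((N : ℝ) ^ 2 + 1) * (2 * Real.exp (-N) +
      (2 * N + 4) * Real.exp (-(Real.log N ^ 2 / 64)) + Real.exp (-Real.log N ^ 2 + 2 * a)) ≤
      Real.exp (-(1 / 128) * Real.log N ^ 2) := by
  filter_upwards [eventually_add_mul_log_le (Real.log (2 * (8 + Real.exp (2 * a)))),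
    eventually_log_sq_add_le_sqrt 0, eventually_ge_atTop 1] with N h1 h2 hN
  have hN1 : (1 : ℝ) ≤ N := by exact_mod_cast hN
  set L := Real.log N with hL
  have hNL : (N : ℝ) = Real.exp L := (Real.exp_log (by linarith)).symm
  have hsq : √(N : ℝ) ≤ N := Real.sqrt_le_iff.2 ⟨by linarith, by nlinarith⟩
  have e1 : Real.exp (-N) ≤ Real.exp (-(L ^ 2 / 64)) :=
    Real.exp_le_exp.2 (by nlinarith [sq_nonneg L])
  have e2 : Real.exp (-L ^ 2 + 2 * a) ≤ Real.exp (2 * a) * Real.exp (-(L ^ 2 / 64)) := by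
    rw [← Real.exp_add]
    exact Real.exp_le_exp.2 (by nlinarith [sq_nonneg L])
  have e3 : ((N : ℝ) ^ 2 + 1) ≤ 2 * N ^ 2 := by nlinarith
  have hpos := Real.exp_pos (-(L ^ 2 / 64))
  have hposa := Real.exp_pos (2 * a)
  calc ((N : ℝ) ^ 2 + 1) * (2 * Real.exp (-N) + (2 * N + 4) * Real.exp (-(L ^ 2 / 64)) +
        Real.exp (-L ^ 2 + 2 * a))
      ≤ (2 * N ^ 2) * (2 * Real.exp (-(L ^ 2 / 64)) + (2 * N + 4) * Real.exp (-(L ^ 2 / 64)) +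
        Real.exp (2 * a) * Real.exp (-(L ^ 2 / 64))) := by gcongr
    _ = (2 * N ^ 2) * (2 + (2 * N + 4) + Real.exp (2 * a)) * Real.exp (-(L ^ 2 / 64)) := by ring
    _ ≤ (2 * N ^ 2) * ((8 + Real.exp (2 * a)) * N) * Real.exp (-(L ^ 2 / 64)) := by
        gcongr
        nlinarith
    _ = (2 * (8 + Real.exp (2 * a))) * N ^ 3 * Real.exp (-(L ^ 2 / 64)) := by ring
    _ = Real.exp (Real.log (2 * (8 + Real.exp (2 * a))) + 3 * L - L ^ 2 / 64) := by
        rw [sub_eq_add_neg, Real.exp_add, Real.exp_add, Real.exp_log (by positivity), hNL,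
          ← Real.exp_nat_mul]
        norm_num
    _ ≤ _ := Real.exp_le_exp.2 (by linarith)

theorem eventually_mul_exp_log_sq_le {c : ℝ} (hc : 0 < c) :
    ∀ᶠ N : ℕ in atTop, 4 * (N : ℝ) ^ 2 / c * Real.exp (-(1 / 128) * Real.log N ^ 2) ≤
      Real.log N ^ 2 / √N := by
  filter_upwards [eventually_add_mul_log_le (Real.log (4 / c)),
    tendsto_log_natCast_atTop.eventually_ge_atTop 1, eventually_ge_atTop 1] with N h1 h2 hN
  have hN1 : (1 : ℝ) ≤ N := by exact_mod_cast hN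
  set L := Real.log N with hL
  have hNL : (N : ℝ) = Real.exp L := (Real.exp_log (by linarith)).symm
  have hsq : √(N : ℝ) ≤ N := Real.sqrt_le_iff.2 ⟨by linarith, by nlinarith⟩
  have hs0 : 0 < √(N : ℝ) := Real.sqrt_pos.2 (by linarith)
  rw [le_div_iff₀ hs0]
  calc 4 * (N : ℝ) ^ 2 / c * Real.exp (-(1 / 128) * L ^ 2) * √N
      ≤ 4 * (N : ℝ) ^ 2 / c * Real.exp (-(1 / 128) * L ^ 2) * N := by gcongr
    _ = 4 / c * N ^ 3 * Real.exp (-(1 / 128) * L ^ 2) := by ring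
    _ = Real.exp (Real.log (4 / c) + 3 * L + -(1 / 128) * L ^ 2) := by
        rw [Real.exp_add, Real.exp_add, Real.exp_log (by positivity), hNL, ← Real.exp_nat_mul]
        norm_num
    _ ≤ 1 := Real.exp_le_one_iff.2 (by linarith)
    _ ≤ L ^ 2 := by nlinarith

theorem summable_exp_neg_mul_log_sq {η : ℝ} (hη : 0 < η) :
    Summable fun N : ℕ => Real.exp (-η * Real.log N ^ 2) := by
  refine Summable.of_norm_bounded_eventually_nat (g := fun N : ℕ => ((N : ℝ) ^ 2)⁻¹)
    (Real.summable_nat_pow_inv.2 one_lt_two) ?_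
  filter_upwards [tendsto_log_natCast_atTop.eventually_ge_atTop (2 / η),
    tendsto_log_natCast_atTop.eventually_ge_atTop 0, eventually_ge_atTop 1] with N h1 h2 hN
  have hN0 : (0 : ℝ) < N := by exact_mod_cast hN
  rw [Real.norm_of_nonneg (Real.exp_pos _).le]
  nth_rw 2 [← Real.exp_log hN0]
  rw [← Real.exp_nat_mul, ← Real.exp_neg]
  refine Real.exp_le_exp.2 ?_
  rw [div_le_iff₀ hη] at h1
  push_cast
  nlinarith

end Asymptotics

/-! ### Assembly of the theorem. -/

theorem meanStat_eq_sum {N : ℕ} (p : ℝ) (x : Sym2 (Fin N) → Bool) :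
    meanStat p x = (1 / (N : ℝ)) * ∑ i, ∑ j, ((if x s(i, j) then 1 else 0) - p) := by
  unfold meanStat linearStat
  simp only [← Finset.sum_mul]
  rw [mul_comm, one_div]
  rfl

theorem theorem3p2 {Ω : Type*} [MeasurableSpace Ω] (P : Measure Ω) [IsProbabilityMeasure P]
    (p₀ lon loff T : ℝ) (hp₀ : p₀ ∈ Set.Ioo (0 : ℝ) 1) (hlon : 0 < lon) (hloff : 0 < loff)
    (hT : 0 < T)
    (init : (N : ℕ) → Sym2 (Fin N) → Ω → Bool)
    (ξ : (N : ℕ) → Bool → Sym2 (Fin N) → ℕ → Ω → ℝ)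
    (hmodel : ∀ N : ℕ, IsOnOffInput P p₀ lon loff (init N) (ξ N)) :
    ∃ (η : ℝ) (E : ℕ → Set Ω) (G : ℕ → ℝ → Ω → ℝ),
      0 < η ∧
      (∀ N : ℕ, 1 ≤ N → MeasurableSet (E N) ∧
        P.real (E N)ᶜ ≤ Real.exp (-η * (Real.log N) ^ 2)) ∧
      (∀ N : ℕ, 1 ≤ N → ∀ t ∈ Set.Icc (0 : ℝ) T, Measurable (G N t)) ∧
      (∀ N : ℕ, 1 ≤ N → ∀ ω ∈ E N, ∀ t ∈ Set.Icc (0 : ℝ) T,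
        principalEigenvalue (adjacencyProcess (init N) (ξ N) t ω) =
          (∫ ω', principalEigenvalue (adjacencyProcess (init N) (ξ N) t ω') ∂P)
            + (1 / (N : ℝ)) * ∑ i : Fin N, ∑ j : Fin N,
                (edgeProcess (init N) (ξ N) s(i, j) t ω - edgeProb P (init N) (ξ N) s(i, j) t)
            + G N t ω * ((Real.log N) ^ 4 / Real.sqrt N)) ∧
      (∀ᵐ ω ∂P, Filter.limsup (fun N : ℕ => ⨆ t ∈ Set.Icc (0 : ℝ) T, ‖G N t ω‖ₑ)
        Filter.atTop < ⊤) ∧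
      (∃ C : ℝ, ∀ᶠ N : ℕ in Filter.atTop, ∀ ω ∈ E N, ∀ t ∈ Set.Icc (0 : ℝ) T,
        |G N t ω| ≤ C) := by
  set C := 3 * (loff + lon) * Real.exp (lon * (2 * T)) with hC
  set c := p₀ * Real.exp (-(lon * T)) with hc
  have hc0 : 0 < c := mul_pos hp₀.1 (Real.exp_pos _)
  set K := 800000 / c ^ 2 + 1 with hK
  have hK0 : 0 < K := by positivity
  have hp : ∀ N : ℕ, ∃ p : ℝ → ℝ, ∀ e t, edgeProb P (init N) (ξ N) e t = p t := fun N => by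
    rcases isEmpty_or_nonempty (Sym2 (Fin N)) with hE | ⟨⟨e₀⟩⟩
    · exact ⟨0, fun e => hE.elim e⟩
    · exact ⟨edgeProb P (init N) (ξ N) e₀, fun e t => (hmodel N).edgeProb_congr e e₀ t⟩
  choose p hp using hp
  let M : ℕ → ℝ → Ω → ℝ := fun N t ω =>
    principalEigenvalue (adjacencyProcess (init N) (ξ N) t ω) -
      (∫ ω', principalEigenvalue (adjacencyProcess (init N) (ξ N) t ω') ∂P) -
      (1 / (N : ℝ)) * ∑ i : Fin N, ∑ j : Fin N,
        (edgeProcess (init N) (ξ N) s(i, j) t ω - edgeProb P (init N) (ξ N) s(i, j) t)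
  have hM : ∀ N t ω, M N t ω =
      principalEigenvalue (configMatrix fun e => edgeState (init N) (ξ N) t e ω) -
      (∫ ω', principalEigenvalue (configMatrix fun e => edgeState (init N) (ξ N) t e ω') ∂P) -
      meanStat (p N t) fun e => edgeState (init N) (ξ N) t e ω := fun N t ω => by
    simp only [M, adjacencyProcess_eq_configMatrix, meanStat_eq_sum, hp, edgeProcess_eq_ite]
  have hlarge : ∀ᶠ N : ℕ in Filter.atTop, 1 ≤ N ∧ 1 ≤ Real.log N ∧
      ∃ E : Set Ω, MeasurableSet E ∧ P.real Eᶜ ≤ Real.exp (-(1 / 128) * Real.log N ^ 2) ∧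
        ∀ t ∈ Set.Icc 0 T, ∀ ω ∈ E, |M N t ω| ≤ K * (Real.log N ^ 2 / √N) := by
    filter_upwards [Filter.eventually_ge_atTop 1,
      tendsto_log_natCast_atTop.eventually_ge_atTop 1, eventually_log_sq_add_le_sqrt (C * T),
      eventually_failure_bound_le (C * T), eventually_mul_exp_log_sq_le hc0,
      (Real.tendsto_sqrt_atTop.comp tendsto_natCast_atTop_atTop).eventually_ge_atTop (132 / c)]
      with N hN hL h1 h2 h3 h4
    refine ⟨hN, hL, ?_⟩
    have h5 : 132 * √N ≤ N * c := by
      have h6 : 132 / c ≤ √N := h4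
      rw [div_le_iff₀ hc0] at h6
      have h7 := Real.mul_self_sqrt (Nat.cast_nonneg (α := ℝ) N)
      have h8 := mul_le_mul_of_nonneg_left h6 (Real.sqrt_nonneg N)
      rw [← mul_assoc, h7] at h8
      linarith
    obtain ⟨E, hE, hPE, hEM⟩ := (hmodel N).exists_event_concentration hN hp₀ hlon hloff hT hL hc hC
      h1 h5 (hp N) h2 h3
    refine ⟨E, hE, hPE, fun t ht ω hω => ?_⟩
    rw [hM]
    exact hEM t ht ω hω
  obtain ⟨N₀, hN₀⟩ := Filter.eventually_atTop.1 hlarge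
  -- For `N = 1` the error scale is 0 because `log 1 = 0`, so the expansion could fail; the
  -- probability bound is then 1 and the empty event is allowed. For other small `N` the whole space
  -- works, since no bound on the remainder is required there.
  have hev : ∀ N : ℕ, ∃ E : Set Ω, MeasurableSet E ∧
      (1 ≤ N → P.real Eᶜ ≤ Real.exp (-(1 / 128) * Real.log N ^ 2)) ∧ (N = 1 → E = ∅) ∧
      (max N₀ 2 ≤ N → ∀ t ∈ Set.Icc 0 T, ∀ ω ∈ E, |M N t ω| ≤ K * (Real.log N ^ 2 / √N)) := by
    intro N
    by_cases hN1 : N = 1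
    · refine ⟨∅, MeasurableSet.empty, fun _ => ?_, fun _ => rfl, fun h => ?_⟩
      · simp [hN1]
      · have := (le_max_right N₀ 2).trans h
        lia
    · by_cases hN : N₀ ≤ N
      · obtain ⟨_, _, E, hE, hPE, hEM⟩ := hN₀ N hN
        exact ⟨E, hE, fun _ => hPE, fun h => absurd h hN1, fun _ => hEM⟩
      · refine ⟨Set.univ, MeasurableSet.univ, fun _ => ?_, fun h => absurd h hN1, fun h => ?_⟩
        · simpa using (Real.exp_pos _).le
        · exact absurd ((le_max_left N₀ 2).trans h) hN
  choose E hEm hEP hE1 hEM using hev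
  have hbound : ∀ N, max N₀ 2 ≤ N → ∀ ω ∈ E N, ∀ t ∈ Set.Icc 0 T,
      |M N t ω / (Real.log N ^ 4 / √N)| ≤ K := by
    intro N hN ω hω t ht
    obtain ⟨hN1, hL, -⟩ := hN₀ N ((le_max_left N₀ 2).trans hN)
    have hs : 0 < √(N : ℝ) := Real.sqrt_pos.2 (by exact_mod_cast hN1)
    have hL4 : 0 < Real.log N ^ 4 / √N := by positivity
    rw [abs_div, abs_of_pos hL4, div_le_iff₀ hL4]
    refine (hEM N hN t ht ω hω).trans ?_
    gcongr ?_ * (?_ / _)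
    -- The argument yields the rate `(log N)² / √N`; the fourth power is a weakening valid because
    -- `log N ≥ 1`.
    exact pow_le_pow_right₀ hL (by norm_num)
  refine ⟨1 / 128, E, fun N t ω => M N t ω / (Real.log N ^ 4 / √N), by norm_num,
    fun N hN => ⟨hEm N, hEP N hN⟩, fun N hN t ht => ?_, fun N hN ω hω t ht => ?_, ?_,
    K, (Filter.eventually_ge_atTop (max N₀ 2)).mono hbound⟩
  · refine Measurable.div_const (c := Real.log N ^ 4 / √N) (f := M N t) ?_
    rw [funext (hM N t)]
    have hX : Measurable fun ω e => edgeState (init N) (ξ N) t e ω :=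
      measurable_pi_iff.2 ((hmodel N).measurable_edgeState t)
    exact (measurable_of_finite fun x : Sym2 (Fin N) → Bool =>
      principalEigenvalue (configMatrix x) -
      (∫ ω', principalEigenvalue (configMatrix fun e => edgeState (init N) (ξ N) t e ω') ∂P) -
      meanStat (p N t) x).comp hX
  · have hN2 : 2 ≤ N := by
      by_contra h
      have hN1 : N = 1 := by lia
      rw [hE1 N hN1] at hω
      exact hω
    have hlog : 0 < Real.log N := Real.log_pos (by exact_mod_cast hN2)
    have hs : 0 < √(N : ℝ) := Real.sqrt_pos.2 (by exact_mod_cast hN)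
    have hL4 : Real.log N ^ 4 / √N ≠ 0 := by positivity
    rw [div_mul_cancel₀ _ hL4]
    ring
  -- Borel–Cantelli: almost surely all but finitely many `E N` occur, and there the deterministic
  -- bound `K` applies.
  · have hsum : ∑' N, P (E N)ᶜ ≠ ⊤ := by
      have h1 : Summable fun N => P.real (E N)ᶜ := by
        refine Summable.of_norm_bounded_eventually_nat
          (summable_exp_neg_mul_log_sq (show (0 : ℝ) < 1 / 128 by norm_num)) ?_
        filter_upwards [Filter.eventually_ge_atTop 1] with N hN
        rw [Real.norm_of_nonneg measureReal_nonneg]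
        exact hEP N hN
      have h2 : ∀ N, P (E N)ᶜ = ENNReal.ofReal (P.real (E N)ᶜ) := fun N => by
        rw [ofReal_measureReal]
      simp only [h2]
      exact h1.tsum_ofReal_ne_top
    filter_upwards [ae_eventually_notMem hsum] with ω hω
    refine lt_of_le_of_lt (Filter.limsup_le_of_le (h := ?_)) (ENNReal.ofReal_lt_top (r := K))
    filter_upwards [hω, Filter.eventually_ge_atTop (max N₀ 2)] with N h1 h2
    refine iSup₂_le fun t ht => ?_
    rw [Real.enorm_eq_ofReal_abs]
    exact ENNReal.ofReal_le_ofReal (hbound N h2 ω (not_not.1 h1) t ht)
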